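/- Let $H$ be a complex Hilbert space with an orthonormal basis $(b_x)_{x\in I}$ of orbitals, the orbital $x$ being placed at a point $\mathrm{pos}(x)\in\mathbb{C}$ of the plane, and suppose that the number of orbitals in a disk of radius $1$ is bounded uniformly in the centre. Write $A_{x,y}=\langle b_x,Ab_y\rangle$ and $|x-y|$ for the distance of the positions. Let $P$ be an orthogonal projection on $H$ such that $|P_{x,y}|\le C_1e^{-C_2|x-y|}$ for some $C_1,C_2>0$ and all $x,y$, and suppose that $P$ commutes with a time reversal $T$, i.e. an antiunitary operator with $T^2=-1$ which is on-site ($\langle b_x,Tb_y\rangle=0$ if $x,y$ have different positions). Fix a point $O\in\mathbb{C}$ (the vertex). *Topological construction.* Let $A,B,C$ be a good partition of the plane with vertex $O$: (i) up to a homeomorphism of the plane that sends $0$ to $O$, the regions are the three sectors $2\pi k/3\le\theta\le 2\pi(k+1)/3$, $k=0,1,2$ (points of a boundary curve being assigned to either of the adjacent regions); (ii) there are $c>0$ and $K\in\mathbb{R}$ with $c(|\alpha-O|+|\beta-O|+|\gamma-O|)\le|\alpha-\beta|+|\beta-\gamma|+|\gamma-\alpha|+K$ for all $\alpha\in A$,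 $\beta\in B$, $\gamma\in C$. Let $Q^t$ be the operator with $Q^t_{x,y}=P_{x,y}$ if $x,y$ lie in the same region and $Q^t_{x,y}=-P_{x,y}$ otherwise. *Geometric construction.* Let $s_{x,y}$ be phases depending on the positions of $x,y$, with $|s_{x,y}|=1$, $s_{x,x}=1$, $s_{y,x}=\overline{s_{x,y}}$, such that for every closed polygon $x_1,x_2,\dots,x_n=x_1$ of sites that does not pass through $O$ the product $\prod_i s_{x_i,x_{i+1}}$ is $-1$ if $O$ is in the loop (odd winding number about $O$) and $1$ otherwise, while for polygons that pass through $O$ this product is only required to be $1$ or $-1$. Let $Q^g$ be the operator with $Q^g_{x,y}=s_{x,y}P_{x,y}$. For a bounded self-adjoint operator $Q$ and $\mu\in(0,1)$ let $\overline{Q}^{\mu}=\chi_{(\mu,\infty)}(Q)$ be its spectral flattening at level $\mu$, and let $\operatorname{tr}^v_\mu(Q)=\operatorname{Tr}(Q-\overline{Q}^{\mu})$ be its trace over vertex states (the usual choice is $\mu=\tfrac12$). Then $Q^t$ and $Q^g$ exist as bounded self-adjoint operators, for all $\mu,\mu'\in(0,1)$ the operators $Q^t-\overline{Q^t}^{\mu}$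 and $Q^g-\overline{Q^g}^{\mu'}$ are trace class, and $$\operatorname{tr}^v_{\mu}(Q^t)-\operatorname{tr}^v_{\mu'}(Q^g)\in 2\mathbb{Z}.$$ -/

import Mathlib

noncomputable section

open scoped ComplexConjugate

/-! ### Operators: matrix entries, trace class, trace, spectral flattening

The one-particle Hilbert space is `H`; `b` is an orthonormal basis of localized orbitals,
indexed by `ι`. -/

/-- The matrix entry `A_{x,y} = ⟨b_x, A b_y⟩`. -/
def matEntry {ι H : Type*} [NormedAddCommGroup H] [InnerProductSpace ℂ H]
    (b : HilbertBasis ι ℂ H) (A : H →L[ℂ] H) (x y : ι) : ℂ :=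
  inner ℂ (b x) (A (b y))

/-- `A` is trace class: `Tr |A| < ∞`, where `|A| = (A* A)^{1/2}`. -/
def IsTraceClassOp {ι H : Type*} [NormedAddCommGroup H] [InnerProductSpace ℂ H] [CompleteSpace H]
    (b : HilbertBasis ι ℂ H) (A : H →L[ℂ] H) : Prop :=
  Summable fun x : ι => (matEntry b (CFC.abs A) x x).re

/-- The trace of a (trace class) operator. -/
def opTrace {ι H : Type*} [NormedAddCommGroup H] [InnerProductSpace ℂ H]
    (b : HilbertBasis ι ℂ H) (A : H →L[ℂ] H) : ℂ :=
  ∑' x : ι, matEntry b A x x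

/-- Spectral flattening of a bounded self-adjoint operator `Q` at the level `μ`: the spectral
projection `χ_{(μ, ∞)}(Q)` (spectrum `≤ μ` goes to `0`, spectrum `> μ` goes to `1`), realised as the
orthogonal projection onto the closure of the range of the positive part `(Q - μ)₊`. -/
def specFlatten {H : Type*} [NormedAddCommGroup H] [InnerProductSpace ℂ H] [CompleteSpace H]
    (μ : ℝ) (Q : H →L[ℂ] H) : H →L[ℂ] H :=
  (LinearMap.range (cfc (fun t : ℝ => max (t - μ) 0) Q).toLinearMap).topologicalClosure.starProjection

/-- The trace over vertex states, `Tr (Q - Q̄)`, with `Q̄` the spectral flattening at level `μ`. -/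
def vertexTrace {ι H : Type*} [NormedAddCommGroup H] [InnerProductSpace ℂ H] [CompleteSpace H]
    (b : HilbertBasis ι ℂ H) (μ : ℝ) (Q : H →L[ℂ] H) : ℂ :=
  opTrace b (Q - specFlatten μ Q)

/-! ### The system -/

/-- The orbitals, placed in the plane `ℂ` by `pos`, have bounded density: the number of orbitals in
a disk of radius one is bounded uniformly in the centre. -/
def HasBoundedDensity {ι : Type*} (pos : ι → ℂ) : Prop :=
  ∃ M : ℕ, ∀ z : ℂ, {x : ι | dist (pos x) z ≤ 1}.encard ≤ M

/-- Exponential decay of the matrix entries away from the diagonal. -/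
def HasExpDecay {ι H : Type*} [NormedAddCommGroup H] [InnerProductSpace ℂ H]
    (b : HilbertBasis ι ℂ H) (pos : ι → ℂ) (P : H →L[ℂ] H) : Prop :=
  ∃ C₁ C₂ : ℝ, 0 < C₁ ∧ 0 < C₂ ∧
    ∀ x y : ι, ‖matEntry b P x y‖ ≤ C₁ * Real.exp (-C₂ * dist (pos x) (pos y))

/-- A time reversal: an antiunitary operator with `T² = -1` that acts on-site. -/
structure IsTimeReversal {ι H : Type*} [NormedAddCommGroup H] [InnerProductSpace ℂ H]
    (b : HilbertBasis ι ℂ H) (pos : ι → ℂ) (T : H ≃ₛₗᵢ[starRingEnd ℂ] H) : Prop where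
  sq_eq_neg : ∀ v, T (T v) = -v
  onsite : ∀ x y : ι, pos x ≠ pos y → inner ℂ (b x) (T (b y)) = 0

/-! ### The topological construction -/

/-- The `k`-th closed sector `2πk/3 ≤ θ ≤ 2π(k+1)/3` of the plane, with apex `0`. -/
def closedSector (k : Fin 3) : Set ℂ :=
  {w | ∃ r θ : ℝ, 0 ≤ r ∧ 2 * Real.pi * (k : ℕ) / 3 ≤ θ ∧ θ ≤ 2 * Real.pi * ((k : ℕ) + 1) / 3 ∧
    w = r * Complex.exp (θ * Complex.I)}

/-- A good partition of the plane into three regions `A = reg ⁻¹' {0}`, `B = reg ⁻¹' {1}`,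
`C = reg ⁻¹' {2}` meeting at the vertex `O`.

* `sectors`: up to a homeomorphism of the plane the regions are three sectors with apex `O`, that
  is, they are bounded by three disjoint curves going from `O` to infinity (a point of a boundary
  curve may be put into either of the adjacent regions).
* `spread`: away from the vertex the three regions are not simultaneously close to one point, at
  the scale of the distance from the vertex; equivalently two different boundary curves move apart
  linearly. Three distinct straight rays satisfy this; it fails if two of the boundary curves are
  parallel at infinity. -/
structure IsGoodPartition (O : ℂ) (reg : ℂ → Fin 3) : Prop where
  sectors : ∃ h : ℂ ≃ₜ ℂ, h 0 = O ∧ ∀ z : ℂ, z ∈ h '' closedSector (reg z)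
  spread : ∃ c K : ℝ, 0 < c ∧ ∀ a b d : ℂ, reg a = 0 → reg b = 1 → reg d = 2 →
    c * (dist a O + dist b O + dist d O) ≤ dist a b + dist b d + dist d a + K

/-- The sign pattern of the topological construction: `+1` on the diagonal blocks `AA, BB, CC` and
`-1` on the off-diagonal blocks. -/
def blockSign (reg : ℂ → Fin 3) (z w : ℂ) : ℂ := if reg z = reg w then 1 else -1

/-! ### The geometric construction -/

/-- The closed polygon `p 0, p 1, …, p n = p 0` passes through `O`. -/
def PolygonPassesThrough (O : ℂ) (n : ℕ) (p : ℕ → ℂ) : Prop :=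
  ∃ i < n, O ∈ segment ℝ (p i) (p (i + 1))

/-- The winding number about `O` of a closed polygon `p 0, p 1, …, p n = p 0` that does not pass
through `O`: the sum of the angles in `(-π, π)` under which the edges are seen from `O`,
divided by `2π`. -/
def polygonWinding (O : ℂ) (n : ℕ) (p : ℕ → ℂ) : ℝ :=
  (∑ i ∈ Finset.range n, Complex.arg ((p (i + 1) - O) / (p i - O))) / (2 * Real.pi)

/-- `O` lies in the loop `p 0, p 1, …, p n = p 0`: the winding number is odd. For a simple polygon
this says that `O` lies in its interior. -/
def LoopEncloses (O : ℂ) (n : ℕ) (p : ℕ → ℂ) : Prop :=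
  ∃ k : ℤ, Odd k ∧ polygonWinding O n p = k

/-- `s` is a system of Peierls phases for the insertion of half a flux quantum at `O`, on the set
`S` of sites: phases with `s_{x,x} = 1` and `s_{y,x} = conj s_{x,y}`, such that the product of the
phases along a loop of sites is `-1` if `O` is in the loop and `1` otherwise. If the loop passes
through `O`, either of the two signs is allowed. -/
structure IsHalfFluxPhase (O : ℂ) (S : Set ℂ) (s : ℂ → ℂ → ℂ) : Prop where
  norm_eq_one : ∀ z ∈ S, ∀ w ∈ S, ‖s z w‖ = 1
  diag : ∀ z ∈ S, s z z = 1
  symm : ∀ z ∈ S, ∀ w ∈ S, s w z = conj (s z w)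
  loop : ∀ (n : ℕ) (p : ℕ → ℂ), (∀ i, p i ∈ S) → p n = p 0 → ¬ PolygonPassesThrough O n p →
    (LoopEncloses O n p → ∏ i ∈ Finset.range n, s (p i) (p (i + 1)) = -1) ∧
    (¬ LoopEncloses O n p → ∏ i ∈ Finset.range n, s (p i) (p (i + 1)) = 1)
  loop_through : ∀ (n : ℕ) (p : ℕ → ℂ), (∀ i, p i ∈ S) → p n = p 0 → PolygonPassesThrough O n p →
    ∏ i ∈ Finset.range n, s (p i) (p (i + 1)) = 1 ∨
    ∏ i ∈ Finset.range n, s (p i) (p (i + 1)) = -1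

/-- `Q` is the operator with entries `Q_{x,y} = s_{x,y} P_{x,y}`, the sign or phase `s` depending on
the positions of the orbitals `x` and `y`. -/
def IsTwistOf {ι H : Type*} [NormedAddCommGroup H] [InnerProductSpace ℂ H]
    (b : HilbertBasis ι ℂ H) (pos : ι → ℂ) (s : ℂ → ℂ → ℂ) (P Q : H →L[ℂ] H) : Prop :=
  ∀ x y : ι, matEntry b Q x y = s (pos x) (pos y) * matEntry b P x y

end

/-! Write $\sigma$ for the block signs. Since $P=P^2$, the entries of $Q^t-(Q^t)^2$ are
$\sum_z(\sigma_{xy}-\sigma_{xz}\sigma_{zy})P_{xz}P_{zy}$. The bracket vanishes unless $x,y,z$ lie in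
three different regions, and then the spread condition turns the decay of $P$ into decay away from
$O$. So $Q^t-(Q^t)^2$ has absolutely summable entries and is nuclear (`IsTwistOf.isNuclear_sub_sq`).
Nuclearity of $Q-Q^2$ lets the spectrum accumulate only at $0$ and $1$. The flattening is then a
continuous function of $Q$, and $Q-\overline Q$ is $(Q-Q^2)g(Q)$ with $g$ continuous
(`IsNuclear.sub_specFlatten`).

The two constructions are compared by gauge transformations. Half flux phases are gauge equivalent
to real signs, and on pairs whose segment avoids $O$ these are, up to a gauge of signs, the
monodromy signs `fluxSign` of $\sqrt{\cdot-O}$ (`IsHalfFluxPhase.exists_gauge_fluxSign`). The block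
signs are, up to gauge, the monodromy of $\sqrt{h^{-1}}$, with $h$ the homeomorphism from the
sectors; since $h$ preserves winding parity, the two monodromies agree
(`IsGoodPartition.exists_gauge_fluxSign`). The comparison may fail only for pairs whose separation
is comparable to their distance from $O$, so after gauging the two operators differ by a nuclear
operator.

The gauged operators have real sign patterns and therefore commute with $T$; they also have equal
diagonals. Hence the difference of the vertex traces is $-\operatorname{Tr}(E_1-E_2)$ for two
$T$-invariant projections with nuclear difference. With $A=E_1-E_2$ and $B=1-E_1-E_2$, the relations
$AB=-BA$ and $A^2+B^2=1$ cancel the trace of $A$ outside its eigenvalues $\pm1$. What remains is a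
difference of dimensions of two $T$-invariant spaces, each even by Kramers degeneracy
(`opTrace_sub_projections_even`). -/

noncomputable section

open scoped ComplexConjugate

/-! ### Nuclear representations -/

section Nuclear

variable {ι H : Type*} [NormedAddCommGroup H] [InnerProductSpace ℂ H]

/-- `A = ∑ₖ |uₖ⟩⟨vₖ|` weakly, with `∑ₖ ‖uₖ‖ ‖vₖ‖ < ∞`. -/
structure NuclearRep {κ : Type*} (u v : κ → H) (A : H →L[ℂ] H) : Prop where
  summable : Summable fun k => ‖u k‖ * ‖v k‖
  hasSum : ∀ x y : H, HasSum (fun k => inner ℂ x (u k) * inner ℂ (v k) y) (inner ℂ x (A y))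

/-- `A` has a nuclear representation indexed by a type in the universe `w`. -/
def IsNuclear.{w, w'} {H : Type w'} [NormedAddCommGroup H] [InnerProductSpace ℂ H]
    (A : H →L[ℂ] H) : Prop :=
  ∃ (κ : Type w) (u v : κ → H), NuclearRep u v A

namespace NuclearRep

variable {κ κ' : Type*} {u v : κ → H} {u' v' : κ' → H} {A B : H →L[ℂ] H}

theorem comp_left (h : NuclearRep u v A) [CompleteSpace H] (B : H →L[ℂ] H) :
    NuclearRep (fun k => B (u k)) v (B * A) where
  summable := by
    refine Summable.of_nonneg_of_le (fun k => by positivity) (fun k => ?_) (h.summable.mul_left ‖B‖)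
    rw [← mul_assoc]
    gcongr
    exact B.le_opNorm _
  hasSum x y := by
    simpa [ContinuousLinearMap.adjoint_inner_left] using
      h.hasSum (ContinuousLinearMap.adjoint B x) y

theorem comp_right (h : NuclearRep u v A) [CompleteSpace H] (B : H →L[ℂ] H) :
    NuclearRep u (fun k => ContinuousLinearMap.adjoint B (v k)) (A * B) where
  summable := by
    refine Summable.of_nonneg_of_le (fun k => by positivity) (fun k => ?_)
      (h.summable.mul_left ‖ContinuousLinearMap.adjoint B‖)
    rw [mul_left_comm]
    gcongr
    exact (ContinuousLinearMap.adjoint B).le_opNorm _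
  hasSum x y := by
    simpa [ContinuousLinearMap.adjoint_inner_left] using h.hasSum x (B y)

theorem smul (h : NuclearRep u v A) (c : ℂ) : NuclearRep (fun k => c • u k) v (c • A) where
  summable := by
    simpa [norm_smul, mul_assoc] using h.summable.mul_left ‖c‖
  hasSum x y := by
    simpa [inner_smul_right, mul_assoc] using (h.hasSum x y).mul_left c

theorem add (h : NuclearRep u v A) (h' : NuclearRep u' v' B) :
    NuclearRep (Sum.elim u u') (Sum.elim v v') (A + B) where
  summable := by
    exact (HasSum.sum (f := fun k => ‖Sum.elim u u' k‖ * ‖Sum.elim v v' k‖)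
      h.summable.hasSum h'.summable.hasSum).summable
  hasSum x y := by
    rw [add_apply, inner_add_right]
    exact HasSum.sum (h.hasSum x y) (h'.hasSum x y)

end NuclearRep

/-- Cauchy–Schwarz in $\ell^2$ followed by Bessel's inequality for each factor. -/
theorem Orthonormal.sum_norm_inner_mul_le {α : Type*} {e : α → H} (he : Orthonormal ℂ e)
    (s : Finset α) (u v : H) :
    ∑ i ∈ s, ‖inner ℂ (e i) u‖ * ‖inner ℂ v (e i)‖ ≤ ‖u‖ * ‖v‖ := by
  refine (Real.sum_mul_le_sqrt_mul_sqrt s _ _).trans ?_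
  gcongr
  · exact Real.sqrt_le_iff.2 ⟨norm_nonneg _, he.sum_inner_products_le u⟩
  · simp_rw [norm_inner_symm v]
    exact Real.sqrt_le_iff.2 ⟨norm_nonneg _, he.sum_inner_products_le v⟩

namespace NuclearRep

variable {κ : Type*} {u v : κ → H} {A : H →L[ℂ] H}

theorem summable_diag_prod (h : NuclearRep u v A) {α : Type*} {e : α → H}
    (he : Orthonormal ℂ e) :
    Summable fun p : κ × α => ‖inner ℂ (e p.2) (u p.1) * inner ℂ (v p.1) (e p.2)‖ := by
  have hk (k : κ) : Summable fun i => ‖inner ℂ (e i) (u k) * inner ℂ (v k) (e i)‖ :=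
    summable_of_sum_le (fun _ => norm_nonneg _) (c := ‖u k‖ * ‖v k‖) fun s => by
      simp_rw [norm_mul]
      exact he.sum_norm_inner_mul_le s _ _
  rw [summable_prod_of_nonneg fun _ => norm_nonneg _]
  refine ⟨hk, Summable.of_nonneg_of_le (fun k => tsum_nonneg fun _ => norm_nonneg _)
    (fun k => ?_) h.summable⟩
  refine (hk k).tsum_le_of_sum_le fun s => ?_
  simp_rw [norm_mul]
  exact he.sum_norm_inner_mul_le s _ _

theorem summable_matEntry (h : NuclearRep u v A) (b : HilbertBasis ι ℂ H) :
    Summable fun x => matEntry b A x x := by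
  have h1 := (h.summable_diag_prod b.orthonormal).of_norm
  have h2 := ((Equiv.prodComm ι κ).summable_iff.2 h1).prod
  refine h2.congr fun x => ?_
  exact ((h.hasSum (b x) (b x)).tsum_eq)

/-- Fubini, justified by `summable_diag_prod`, and Parseval in $x$ for each fixed $k$. This makes
the trace independent of the basis. -/
theorem opTrace_eq (h : NuclearRep u v A) (b : HilbertBasis ι ℂ H) :
    opTrace b A = ∑' k, inner ℂ (v k) (u k) := by
  have h1 := (h.summable_diag_prod b.orthonormal).of_norm
  have h2 : opTrace b A = ∑' x, ∑' k, inner ℂ (b x) (u k) * inner ℂ (v k) (b x) :=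
    tsum_congr fun x => ((h.hasSum (b x) (b x)).tsum_eq).symm
  have h3 : Summable (Function.uncurry fun (x : ι) (k : κ) =>
      inner ℂ (b x) (u k) * inner ℂ (v k) (b x)) := (Equiv.prodComm ι κ).summable_iff.2 h1
  rw [h2, ← h3.tsum_comm]
  refine tsum_congr fun k => ?_
  rw [← b.tsum_inner_mul_inner (v k) (u k)]
  exact tsum_congr fun x => mul_comm _ _

/-- Both traces equal $\sum_k\langle v_k,Bu_k\rangle$. -/
theorem opTrace_mul_comm (h : NuclearRep u v A) [CompleteSpace H] (b : HilbertBasis ι ℂ H)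
    (B : H →L[ℂ] H) : opTrace b (A * B) = opTrace b (B * A) := by
  rw [(h.comp_right B).opTrace_eq b, (h.comp_left B).opTrace_eq b]
  simp [ContinuousLinearMap.adjoint_inner_left]

theorem sum_norm_inner_le (h : NuclearRep u v A) {α : Type*} {e : α → H}
    (he : Orthonormal ℂ e) (s : Finset α) :
    ∑ i ∈ s, ‖inner ℂ (e i) (A (e i))‖ ≤ ∑' k, ‖u k‖ * ‖v k‖ := by
  have h1 := h.summable_diag_prod he
  have h2 (i : α) : Summable fun k => ‖inner ℂ (e i) (u k) * inner ℂ (v k) (e i)‖ :=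
    ((Equiv.prodComm α κ).summable_iff.2 h1).prod_factor i
  calc ∑ i ∈ s, ‖inner ℂ (e i) (A (e i))‖
      ≤ ∑ i ∈ s, ∑' k, ‖inner ℂ (e i) (u k) * inner ℂ (v k) (e i)‖ := by
        refine Finset.sum_le_sum fun i _ => ?_
        rw [← (h.hasSum (e i) (e i)).tsum_eq]
        exact norm_tsum_le_tsum_norm (h2 i)
    _ = ∑' k, ∑ i ∈ s, ‖inner ℂ (e i) (u k) * inner ℂ (v k) (e i)‖ :=
        (Summable.tsum_finsetSum fun i _ => h2 i).symm
    _ ≤ ∑' k, ‖u k‖ * ‖v k‖ := by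
        refine Summable.tsum_le_tsum (fun k => ?_) (summable_sum fun i _ => h2 i) h.summable
        simp_rw [norm_mul]
        exact he.sum_norm_inner_mul_le s _ _

end NuclearRep

namespace IsNuclear

universe w

variable {A B : H →L[ℂ] H}

theorem mul_left [CompleteSpace H] (h : IsNuclear.{w} A) (B : H →L[ℂ] H) :
    IsNuclear.{w} (B * A) := by
  obtain ⟨κ, u, v, h⟩ := h
  exact ⟨κ, _, _, h.comp_left B⟩

theorem mul_right [CompleteSpace H] (h : IsNuclear.{w} A) (B : H →L[ℂ] H) :
    IsNuclear.{w} (A * B) := by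
  obtain ⟨κ, u, v, h⟩ := h
  exact ⟨κ, _, _, h.comp_right B⟩

theorem smul (h : IsNuclear.{w} A) (c : ℂ) : IsNuclear.{w} (c • A) := by
  obtain ⟨κ, u, v, h⟩ := h
  exact ⟨κ, _, _, h.smul c⟩

theorem neg (h : IsNuclear.{w} A) : IsNuclear.{w} (-A) := by
  simpa using h.smul (-1)

theorem add (h : IsNuclear.{w} A) (h' : IsNuclear.{w} B) : IsNuclear.{w} (A + B) := by
  obtain ⟨κ, u, v, h⟩ := h
  obtain ⟨κ', u', v', h'⟩ := h'
  exact ⟨κ ⊕ κ', _, _, h.add h'⟩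

theorem sub (h : IsNuclear.{w} A) (h' : IsNuclear.{w} B) : IsNuclear.{w} (A - B) := by
  simpa [sub_eq_add_neg] using h.add h'.neg

theorem summable_matEntry (h : IsNuclear.{w} A) (b : HilbertBasis ι ℂ H) :
    Summable fun x => matEntry b A x x := by
  obtain ⟨κ, u, v, h⟩ := h
  exact h.summable_matEntry b

theorem opTrace_mul_comm [CompleteSpace H] (h : IsNuclear.{w} A) (b : HilbertBasis ι ℂ H)
    (B : H →L[ℂ] H) : opTrace b (A * B) = opTrace b (B * A) := by
  obtain ⟨κ, u, v, h⟩ := h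
  exact h.opTrace_mul_comm b B

/-- Index types in `Type` suffice: the orthonormal families tested later are indexed by finite sets
of reals. -/
theorem exists_sum_norm_inner_le (h : IsNuclear.{w} A) :
    ∃ N : ℝ, ∀ (α : Type) (e : α → H), Orthonormal ℂ e → ∀ s : Finset α,
      ∑ i ∈ s, ‖inner ℂ (e i) (A (e i))‖ ≤ N := by
  obtain ⟨κ, u, v, h⟩ := h
  exact ⟨_, fun α e he s => h.sum_norm_inner_le he s⟩

end IsNuclear

/-! ### Operators and their matrix entries. -/

theorem matEntry_add (b : HilbertBasis ι ℂ H) (A B : H →L[ℂ] H) (x y : ι) :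
    matEntry b (A + B) x y = matEntry b A x y + matEntry b B x y := by
  simp [matEntry]

theorem matEntry_sub (b : HilbertBasis ι ℂ H) (A B : H →L[ℂ] H) (x y : ι) :
    matEntry b (A - B) x y = matEntry b A x y - matEntry b B x y := by
  simp [matEntry]

theorem opTrace_add {b : HilbertBasis ι ℂ H} {A B : H →L[ℂ] H}
    (hA : Summable fun x => matEntry b A x x) (hB : Summable fun x => matEntry b B x x) :
    opTrace b (A + B) = opTrace b A + opTrace b B := by
  simp only [opTrace, matEntry_add]
  exact hA.tsum_add hB

theorem opTrace_sub {b : HilbertBasis ι ℂ H} {A B : H →L[ℂ] H}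
    (hA : Summable fun x => matEntry b A x x) (hB : Summable fun x => matEntry b B x x) :
    opTrace b (A - B) = opTrace b A - opTrace b B := by
  simp only [opTrace, matEntry_sub]
  exact hA.tsum_sub hB

theorem ContinuousLinearMap.ext_matEntry (b : HilbertBasis ι ℂ H) {A B : H →L[ℂ] H}
    (h : ∀ x y, matEntry b A x y = matEntry b B x y) : A = B := by
  refine ContinuousLinearMap.ext_on (Submodule.dense_iff_topologicalClosure_eq_top.2 b.dense_span)
    ?_
  rintro _ ⟨y, rfl⟩
  refine b.repr.injective (Subtype.ext (funext fun x => ?_))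
  rw [b.repr_apply_apply, b.repr_apply_apply]
  exact h x y

theorem hasSum_matEntry_mul [CompleteSpace H] (b : HilbertBasis ι ℂ H) (A B : H →L[ℂ] H)
    (x y : ι) :
    HasSum (fun z => matEntry b A x z * matEntry b B z y) (matEntry b (A * B) x y) := by
  simpa [matEntry, ContinuousLinearMap.adjoint_inner_left] using
    b.hasSum_inner_mul_inner (ContinuousLinearMap.adjoint A (b x)) (B (b y))

theorem matEntry_adjoint [CompleteSpace H] (b : HilbertBasis ι ℂ H) (A : H →L[ℂ] H) (x y : ι) :
    matEntry b (star A) x y = conj (matEntry b A y x) := by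
  simp [matEntry, ContinuousLinearMap.star_eq_adjoint, ContinuousLinearMap.adjoint_inner_right]

/-- An operator with absolutely summable matrix entries is nuclear. -/
theorem isNuclear_of_summable_matEntry.{w, w'} {ι : Type w} {H : Type w'}
    [NormedAddCommGroup H] [InnerProductSpace ℂ H] [CompleteSpace H] (b : HilbertBasis ι ℂ H)
    {A : H →L[ℂ] H} (h : Summable fun p : ι × ι => ‖matEntry b A p.1 p.2‖) :
    IsNuclear.{w} A := by
  refine ⟨ι × ι, fun p => matEntry b A p.1 p.2 • b p.1, fun p => b p.2, ?_, fun x y => ?_⟩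
  · simpa [norm_smul, b.orthonormal.1] using h
  have hs : Summable fun p : ι × ι =>
      inner ℂ x (matEntry b A p.1 p.2 • b p.1) * inner ℂ (b p.2) y := by
    refine Summable.of_norm_bounded (h.mul_right (‖x‖ * ‖y‖)) fun p => ?_
    rw [inner_smul_right, norm_mul, norm_mul, mul_assoc]
    gcongr
    · simpa [b.orthonormal.1] using norm_inner_le_norm (𝕜 := ℂ) x (b p.1)
    · simpa [b.orthonormal.1] using norm_inner_le_norm (𝕜 := ℂ) (b p.2) y
  have h1 (z : ι) : HasSum (fun z' =>
      inner ℂ x (matEntry b A z z' • b z) * inner ℂ (b z') y)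
      (inner ℂ x (b z) * inner ℂ (b z) (A y)) := by
    have := (b.hasSum_inner_mul_inner (ContinuousLinearMap.adjoint A (b z)) y).mul_left
      (inner ℂ x (b z))
    simp only [ContinuousLinearMap.adjoint_inner_left] at this
    convert! this using 1
    ext z'
    rw [inner_smul_right, matEntry]
    ring
  have h2 := hs.hasSum.prod_fiberwise h1
  rw [← h2.unique (b.hasSum_inner_mul_inner x (A y))]
  exact hs.hasSum

/-- Absolutely summable entries define a bounded operator. -/
theorem exists_matEntry_eq_of_summable [CompleteSpace H] (b : HilbertBasis ι ℂ H)
    (m : ι → ι → ℂ) (h : Summable fun p : ι × ι => ‖m p.1 p.2‖) :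
    ∃ D : H →L[ℂ] H, ∀ x y, matEntry b D x y = m x y := by
  have hs : Summable fun p : ι × ι => m p.1 p.2 • InnerProductSpace.rankOne ℂ (b p.1) (b p.2) := by
    refine Summable.of_norm (h.congr fun p => ?_)
    simp [norm_smul, b.orthonormal.1]
  refine ⟨∑' p : ι × ι, m p.1 p.2 • InnerProductSpace.rankOne ℂ (b p.1) (b p.2), fun x y => ?_⟩
  have h1 := (hs.hasSum.mapL (ContinuousLinearMap.apply ℂ H (b y))).mapL (innerSL ℂ (b x))
  refine h1.unique ?_
  classical
  convert! hasSum_ite_eq (x, y) (m x y) using 1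
  ext ⟨p, q⟩
  have := orthonormal_iff_ite.1 b.orthonormal
  simp only [ContinuousLinearMap.apply_apply, map_smul,
    InnerProductSpace.rankOne_apply, innerSL_apply_apply, this, smul_eq_mul, Prod.mk.injEq]
  by_cases hp : x = p <;> by_cases hq : q = y <;> simp [hp, hq, eq_comm]

end Nuclear

/-! ### Spectral consequences of nuclearity. -/

section SpectralTheory

universe w

variable {ι H : Type*} [NormedAddCommGroup H] [InnerProductSpace ℂ H] [CompleteSpace H]

open Filter Topology

theorem IsSelfAdjoint.inner_apply_comm {B : H →L[ℂ] H} (hB : IsSelfAdjoint B) (x y : H) :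
    inner ℂ (B x) y = inner ℂ x (B y) := by
  conv_lhs => rw [← hB.adjoint_eq]
  exact ContinuousLinearMap.adjoint_inner_left B y x

theorem exists_unit_vector_cfc {Q : H →L[ℂ] H} (hQ : IsSelfAdjoint Q) {φ : ℝ → ℝ}
    (hφ : Continuous φ) {t : ℝ} (ht : t ∈ spectrum ℝ Q) (hφt : φ t ≠ 0) :
    ∃ v : H, ‖cfc φ Q v‖ = 1 := by
  have h0 : cfc φ Q ≠ 0 := by
    intro h
    have h' : cfc φ Q = cfc (fun _ => (0 : ℝ)) Q := by rw [h, cfc_const_zero]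
    exact hφt ((cfc_eq_cfc_iff_eqOn (a := Q) (hf := hφ.continuousOn)).1 h' ht)
  obtain ⟨v, hv⟩ : ∃ v, cfc φ Q v ≠ 0 := by
    by_contra! h
    exact h0 (ContinuousLinearMap.ext h)
  refine ⟨((‖cfc φ Q v‖⁻¹ : ℝ) : ℂ) • v, ?_⟩
  rw [map_smul, norm_smul, Complex.norm_real, norm_inv, norm_norm,
    inv_mul_cancel₀ (norm_ne_zero_iff.2 hv)]

/-- The operator $\varphi(Q)(k(Q)-\delta)\varphi(Q)$ is nonnegative, because $k\ge\delta$ wherever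
$\varphi\neq0$. -/
theorem le_re_inner_cfc {Q : H →L[ℂ] H} (hQ : IsSelfAdjoint Q) {φ k : ℝ → ℝ}
    (hφ : Continuous φ) (hk : Continuous k) {δ : ℝ} (h : ∀ t, φ t ≠ 0 → δ ≤ k t) (v : H) :
    δ * ‖cfc φ Q v‖ ^ 2 ≤ (inner ℂ (cfc φ Q v) (cfc k Q (cfc φ Q v))).re := by
  have h1 : 0 ≤ cfc (fun t => φ t * (k t - δ) * φ t) Q := by
    refine cfc_nonneg fun t _ => ?_
    by_cases ht : φ t = 0
    · simp [ht]
    · have := h t ht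
      nlinarith [mul_nonneg (sub_nonneg.2 this) (mul_self_nonneg (φ t))]
  have h2 : cfc (fun t => φ t * (k t - δ) * φ t) Q
      = cfc φ Q * (cfc k Q - (δ : ℂ) • 1) * cfc φ Q := by
    rw [cfc_mul (fun t => φ t * (k t - δ)) φ Q (by fun_prop) (by fun_prop),
      cfc_mul φ (fun t => k t - δ) Q (by fun_prop) (by fun_prop), cfc_sub k (fun _ => δ) Q,
      cfc_const δ Q, Algebra.algebraMap_eq_smul_one, Complex.coe_smul]
  rw [h2] at h1
  have h3 : 0 ≤ (inner ℂ v (cfc φ Q ((cfc k Q - (δ : ℂ) • 1) (cfc φ Q v)))).re :=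
    ((ContinuousLinearMap.nonneg_iff_isPositive _).1 h1).re_inner_nonneg_right v
  have h4 : IsSelfAdjoint (cfc φ Q) := IsSelfAdjoint.cfc
  rw [← h4.inner_apply_comm] at h3
  have h5 : (inner ℂ (cfc φ Q v) ((cfc k Q - (δ : ℂ) • 1) (cfc φ Q v))).re
      = (inner ℂ (cfc φ Q v) (cfc k Q (cfc φ Q v))).re - δ * ‖cfc φ Q v‖ ^ 2 := by
    change (inner ℂ (cfc φ Q v) (cfc k Q (cfc φ Q v) - (δ : ℂ) • cfc φ Q v)).re = _
    rw [inner_sub_right, inner_smul_right, inner_self_eq_norm_sq_to_K, Complex.sub_re,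
      Complex.re_ofReal_mul]
    congr 2
    exact (congrArg Complex.re (Complex.ofReal_pow _ 2)).symm.trans (Complex.ofReal_re _)
  linarith

theorem exists_separation_radius {k : ℝ → ℝ} (hk : Continuous k) {δ : ℝ} (hδ : 0 < δ)
    (s : Finset ℝ) (hs : ∀ t ∈ s, δ ≤ k t) :
    ∃ r > 0, (∀ t ∈ s, ∀ x, |x - t| < r → δ / 2 ≤ k x) ∧
      ∀ t ∈ s, ∀ t' ∈ s, t ≠ t' → 2 * r ≤ |t - t'| := by
  have h1 : ∀ᶠ r in 𝓝[>] (0 : ℝ), ∀ t ∈ s, ∀ x, |x - t| < r → δ / 2 ≤ k x := by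
    rw [Filter.eventually_all_finset]
    intro t ht
    have : ∀ᶠ x in 𝓝 t, δ / 2 < k x :=
      hk.continuousAt.eventually_const_lt (by linarith [hs t ht])
    obtain ⟨ε, hε, h⟩ := Metric.eventually_nhds_iff.1 this
    filter_upwards [Ioo_mem_nhdsGT hε] with r hr x hx
    exact (h (hx.trans hr.2)).le
  have h2 : ∀ᶠ r in 𝓝[>] (0 : ℝ), ∀ t ∈ s, ∀ t' ∈ s, t ≠ t' → 2 * r ≤ |t - t'| := by
    rw [Filter.eventually_all_finset]
    intro t _
    rw [Filter.eventually_all_finset]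
    intro t' _
    by_cases h : t = t'
    · simp [h]
    · have : 0 < |t - t'| / 2 := by
        have := abs_pos.2 (sub_ne_zero.2 h)
        positivity
      filter_upwards [Ioo_mem_nhdsGT this] with r hr _
      linarith [hr.2]
  obtain ⟨r, ⟨h1, h2⟩, hr⟩ := ((h1.and h2).and self_mem_nhdsWithin).exists
  exact ⟨r, hr, h1, h2⟩

/-- If `k(Q)` is nuclear, then only finitely many points `t` of the spectrum of `Q` have
`k t ≥ δ`. -/
theorem IsNuclear.finite_spectrum {Q : H →L[ℂ] H} (hQ : IsSelfAdjoint Q) {k : ℝ → ℝ}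
    (hk : Continuous k) (hn : IsNuclear.{w} (cfc k Q)) {δ : ℝ} (hδ : 0 < δ) :
    {t ∈ spectrum ℝ Q | δ ≤ k t}.Finite := by
  obtain ⟨N, hN⟩ := hn.exists_sum_norm_inner_le
  by_contra hinf
  -- Around $n$ such spectral points, tent functions with disjoint supports give $n$ orthonormal
  -- vectors, each with diagonal entry of $k(Q)$ at least $\delta/2$. The choice of $n$ makes the
  -- sum exceed the nuclear bound $N$.
  obtain ⟨n, hn⟩ := exists_nat_gt (N / (δ / 2))
  obtain ⟨s, hs, hcard⟩ := Set.Infinite.exists_subset_card_eq hinf n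
  obtain ⟨r, hr, h1, h2⟩ := exists_separation_radius hk hδ s fun t ht => (hs ht).2
  let φ : ℝ → ℝ → ℝ := fun t x => max (r - |x - t|) 0
  have hφ (t) : Continuous (φ t) := by fun_prop
  have hφ0 (t x) (h : φ t x ≠ 0) : |x - t| < r := by
    by_contra! h'
    exact h (max_eq_right (by linarith))
  have hv (t : s) : ∃ v : H, ‖cfc (φ t) Q v‖ = 1 :=
    exists_unit_vector_cfc hQ (hφ t) (hs t.2).1 (by simp [φ, hr.ne', hr.le])
  choose v hv using hv
  have ho : Orthonormal ℂ fun t : s => cfc (φ t) Q (v t) := by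
    refine ⟨hv, fun t t' htt => ?_⟩
    have hz : cfc (φ t) Q * cfc (φ t') Q = 0 := by
      rw [← cfc_mul (φ t) (φ t') Q (hφ t).continuousOn (hφ t').continuousOn]
      rw [← cfc_const_zero ℝ Q]
      congr 1
      ext x
      by_contra hne
      have ha := hφ0 t x (left_ne_zero_of_mul hne)
      have hb := hφ0 t' x (right_ne_zero_of_mul hne)
      have hc := h2 t t.2 t' t'.2 (fun h => htt (Subtype.ext h))
      have := abs_sub_le (t : ℝ) x t'
      rw [abs_sub_comm] at ha
      linarith
    have h4 : IsSelfAdjoint (cfc (φ t) Q) := IsSelfAdjoint.cfc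
    change inner ℂ (cfc (φ t) Q (v t)) (cfc (φ t') Q (v t')) = 0
    rw [h4.inner_apply_comm]
    change inner ℂ (v t) ((cfc (φ t) Q * cfc (φ t') Q) (v t')) = 0
    simp [hz]
  have h3 := hN s _ ho Finset.univ
  have h4 : ∑ _i : s, δ / 2 ≤ N := by
    refine le_trans (Finset.sum_le_sum fun t _ => ?_) h3
    have := le_re_inner_cfc hQ (hφ t) hk (fun x hx => h1 t t.2 x (hφ0 t x hx)) (v t)
    rw [hv t, one_pow, mul_one] at this
    exact this.trans (Complex.re_le_norm _)
  rw [Finset.sum_const, Finset.card_univ, Fintype.card_coe, hcard, nsmul_eq_mul] at h4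
  rw [div_lt_iff₀ (by positivity)] at hn
  linarith

/-- A nuclear self-adjoint operator is trace class. -/
theorem IsNuclear.isTraceClassOp {A : H →L[ℂ] H} (hn : IsNuclear.{w} A) (hA : IsSelfAdjoint A)
    (b : HilbertBasis ι ℂ H) : IsTraceClassOp b A := by
  obtain ⟨κ, u, v, hn⟩ := hn
  have habs : CFC.abs A = cfc (fun t : ℝ => |t|) A := CFC.abs_eq_cfc_norm A
  have hpos (x : ι) : 0 ≤ (matEntry b (CFC.abs A) x x).re :=
    ((ContinuousLinearMap.nonneg_iff_isPositive _).1 (CFC.abs_nonneg A)).re_inner_nonneg_right _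
  refine summable_of_sum_le hpos (c := ∑' k, ‖u k‖ * ‖v k‖) fun s => ?_
  refine le_of_forall_pos_le_add fun ε hε => ?_
  obtain ⟨η, hη, hηε⟩ : ∃ η > 0, s.card * η ≤ ε := by
    refine ⟨ε / (s.card + 1), by positivity, ?_⟩
    rw [mul_div_assoc', div_le_iff₀ (by positivity)]
    nlinarith
  -- A continuous substitute for the sign function: $\|h(A)\|\le1$ keeps the nuclear bound of $A$,
  -- while $h(A)A$ is within $\eta$ of $|A|$.
  let h : ℝ → ℝ := fun t => t / (|t| + η)
  have hη0 (t : ℝ) : |t| + η ≠ 0 := by positivity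
  have hc : Continuous h := by fun_prop (disch := exact hη0 _)
  have hn1 : ‖cfc h A‖ ≤ 1 := by
    refine norm_cfc_le zero_le_one fun t _ => ?_
    simp only [h, Real.norm_eq_abs, abs_div]
    rw [abs_of_pos (show 0 < |t| + η by positivity), div_le_one (by positivity)]
    linarith
  have hn2 : ‖CFC.abs A - cfc h A * A‖ ≤ η := by
    have : cfc h A * A = cfc (fun t => h t * t) A := by
      rw [cfc_mul h (fun t => t) A hc.continuousOn (by fun_prop), cfc_id' ℝ A]
    rw [this, habs, ← cfc_sub _ _ A (by fun_prop) (by fun_prop)]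
    refine norm_cfc_le hη.le fun t _ => ?_
    have h1 : |t| - h t * t = η * (|t| / (|t| + η)) := by
      have := hη0 t
      simp only [h]
      field_simp
      rw [← sq_abs t]
      ring
    rw [h1, norm_mul, Real.norm_of_nonneg hη.le]
    refine mul_le_of_le_one_right hη.le ?_
    rw [Real.norm_of_nonneg (by positivity), div_le_one (by positivity)]
    linarith
  have h5 := (hn.comp_left (cfc h A)).sum_norm_inner_le b.orthonormal s
  have h6 : ∑' k, ‖cfc h A (u k)‖ * ‖v k‖ ≤ ∑' k, ‖u k‖ * ‖v k‖ := by
    refine Summable.tsum_le_tsum (fun k => ?_) (hn.comp_left (cfc h A)).summable hn.summable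
    gcongr
    simpa using (cfc h A).le_of_opNorm_le hn1 (u k)
  have h7 (x : ι) : (matEntry b (CFC.abs A) x x).re
      ≤ ‖inner ℂ (b x) ((cfc h A * A) (b x))‖ + η := by
    have : matEntry b (CFC.abs A) x x
        = inner ℂ (b x) ((cfc h A * A) (b x)) + inner ℂ (b x) ((CFC.abs A - cfc h A * A) (b x)) := by
      rw [← inner_add_right, ← add_apply, add_sub_cancel]
      rfl
    rw [this]
    refine (Complex.re_le_norm _).trans ((norm_add_le _ _).trans ?_)
    gcongr
    refine (norm_inner_le_norm _ _).trans ?_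
    rw [b.orthonormal.1, one_mul]
    simpa [b.orthonormal.1] using (CFC.abs A - cfc h A * A).le_of_opNorm_le hn2 (b x)
  calc ∑ x ∈ s, (matEntry b (CFC.abs A) x x).re
      ≤ ∑ x ∈ s, (‖inner ℂ (b x) ((cfc h A * A) (b x))‖ + η) := Finset.sum_le_sum fun x _ => h7 x
    _ ≤ _ := by
      rw [Finset.sum_add_distrib, Finset.sum_const, nsmul_eq_mul]
      linarith

end SpectralTheory

/-! ### Spectral flattening and the gap above the level. -/

section Flattening

universe w

variable {ι H : Type*} [NormedAddCommGroup H] [InnerProductSpace ℂ H] [CompleteSpace H]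

open Filter Topology

/-- The continuous step from `0` (up to `μ`) to `1` (from `c` on). -/
def stepFun (μ c : ℝ) (t : ℝ) : ℝ := max 0 (min 1 ((t - μ) / (c - μ)))

theorem continuous_stepFun (μ c : ℝ) : Continuous (stepFun μ c) := by
  unfold stepFun
  fun_prop

theorem stepFun_of_le {μ c t : ℝ} (h : μ < c) (ht : t ≤ μ) : stepFun μ c t = 0 := by
  have : (t - μ) / (c - μ) ≤ 0 :=
    div_nonpos_of_nonpos_of_nonneg (by linarith) (by linarith)
  exact max_eq_left ((min_le_right _ _).trans this)

theorem stepFun_of_ge {μ c t : ℝ} (h : μ < c) (ht : c ≤ t) : stepFun μ c t = 1 := by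
  have : 1 ≤ (t - μ) / (c - μ) := by
    rw [le_div_iff₀ (by linarith)]
    linarith
  rw [stepFun, min_eq_left this, max_eq_right zero_le_one]

/-- The spectral flattening is given by continuous functional calculus if there is a gap above
the level. -/
theorem specFlatten_eq_cfc {Q : H →L[ℂ] H} (hQ : IsSelfAdjoint Q) {μ c : ℝ} (hμc : μ < c)
    (hgap : ∀ t ∈ spectrum ℝ Q, t ≤ μ ∨ c ≤ t) :
    specFlatten μ Q = cfc (stepFun μ c) Q := by
  have hstep := continuous_stepFun μ c
  set E := cfc (stepFun μ c) Q with hE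
  have hEE : E * E = E := by
    rw [hE, ← cfc_mul _ _ Q hstep.continuousOn hstep.continuousOn]
    refine cfc_congr fun t ht => ?_
    rcases hgap t ht with h | h
    · simp [stepFun_of_le hμc h]
    · simp [stepFun_of_ge hμc h]
  have hEs : IsSelfAdjoint E := IsSelfAdjoint.cfc
  have hproj : IsStarProjection E := ⟨hEE, hEs⟩
  set R := cfc (fun t : ℝ => max (t - μ) 0) Q with hR
  have h1 : E * R = R := by
    rw [hE, hR, ← cfc_mul _ _ Q hstep.continuousOn (by fun_prop)]
    refine cfc_congr fun t ht => ?_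
    rcases hgap t ht with h | h
    · simp [stepFun_of_le hμc h, h]
    · simp [stepFun_of_ge hμc h]
  -- On the spectrum above the gap, $t-\mu\ge c-\mu$, so this function inverts the positive part
  -- there; the maximum keeps it continuous elsewhere. With `h1`, the operators $R$ and $E$ have the
  -- same range.
  have h2 : R * cfc (fun t : ℝ => (max (t - μ) (c - μ))⁻¹) Q = E := by
    have hc : Continuous fun t : ℝ => (max (t - μ) (c - μ))⁻¹ := by
      refine Continuous.inv₀ (by fun_prop) fun t => ?_
      exact (lt_of_lt_of_le (by linarith) (le_max_right (t - μ) (c - μ))).ne'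
    rw [hE, hR, ← cfc_mul _ _ Q (by fun_prop) hc.continuousOn]
    refine cfc_congr fun t ht => ?_
    rcases hgap t ht with h | h
    · simp [stepFun_of_le hμc h, h]
    · have : 0 < t - μ := by linarith
      simp only [stepFun_of_ge hμc h]
      rw [max_eq_left this.le, max_eq_left (by linarith), mul_inv_cancel₀ this.ne']
  have hrange : LinearMap.range R.toLinearMap = LinearMap.range E.toLinearMap := by
    apply le_antisymm
    · rintro _ ⟨v, rfl⟩
      exact ⟨R v, by simpa using congr($h1 v)⟩
    · rintro _ ⟨v, rfl⟩
      exact ⟨cfc (fun t : ℝ => (max (t - μ) (c - μ))⁻¹) Q v, by simpa using congr($h2 v)⟩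
  have hclosed : IsClosed (LinearMap.range E.toLinearMap : Set H) := by
    have : (LinearMap.range E.toLinearMap : Set H) = {v | E v = v} := by
      ext v
      constructor
      · rintro ⟨w, rfl⟩
        simpa using congr($hEE w)
      · intro h
        exact ⟨v, h⟩
    rw [this]
    exact isClosed_eq E.continuous continuous_id
  have hcl : (LinearMap.range R.toLinearMap).topologicalClosure
      = LinearMap.range E.toLinearMap := by
    rw [hrange]
    exact hclosed.submodule_topologicalClosure_eq
  refine ContinuousLinearMap.ext fun v => ?_
  unfold specFlatten
  refine Submodule.eq_starProjection_of_mem_of_inner_eq_zero ?_ ?_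
  · rw [hcl]
    exact ⟨v, rfl⟩
  · intro w hw
    rw [hcl] at hw
    obtain ⟨w, rfl⟩ := hw
    change inner ℂ (v - E v) (E w) = 0
    rw [← hEs.inner_apply_comm, map_sub]
    have : E (E v) = E v := congr($hEE v)
    rw [this, sub_self, inner_zero_left]

theorem isStarProjection_specFlatten (μ : ℝ) (Q : H →L[ℂ] H) :
    IsStarProjection (specFlatten μ Q) := isStarProjection_starProjection

theorem exists_gap_of_finite {S : Set ℝ} {a b : ℝ} (hab : a < b) (h : (S ∩ Set.Icc a b).Finite) :
    ∃ c, a < c ∧ c < b ∧ ∀ t ∈ S, t ≤ a ∨ c ≤ t := by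
  have h1 : ((S ∩ Set.Icc a b) \ {a}).Finite := h.sdiff
  have h2 : ((S ∩ Set.Icc a b) \ {a})ᶜ ∈ 𝓝 a := h1.isClosed.isOpen_compl.mem_nhds (by simp)
  obtain ⟨ε, hε, h3⟩ := Metric.mem_nhds_iff.1 h2
  refine ⟨a + min (ε / 2) ((b - a) / 2), ?_, ?_, fun t ht => ?_⟩
  · have : 0 < min (ε / 2) ((b - a) / 2) := lt_min (by linarith) (by linarith)
    linarith
  · have := min_le_right (ε / 2) ((b - a) / 2)
    linarith
  · by_contra! hcon
    have h4 := min_le_right (ε / 2) ((b - a) / 2)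
    have h5 := min_le_left (ε / 2) ((b - a) / 2)
    have : t ∈ Metric.ball a ε := by
      rw [Metric.mem_ball, Real.dist_eq, abs_of_pos (by linarith)]
      linarith
    exact h3 this ⟨⟨ht, hcon.1.le, by linarith⟩, hcon.1.ne'⟩

/-- If `Q - Q²` is nuclear, then the spectrum of `Q` has a gap directly above each level in
`(0, 1)`. -/
theorem IsNuclear.exists_spectral_gap {Q : H →L[ℂ] H} (hQ : IsSelfAdjoint Q)
    (hn : IsNuclear.{w} (Q - Q * Q)) {μ : ℝ} (hμ : μ ∈ Set.Ioo (0 : ℝ) 1) :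
    ∃ c, μ < c ∧ c < 1 ∧ ∀ t ∈ spectrum ℝ Q, t ≤ μ ∨ c ≤ t := by
  obtain ⟨h0, h1⟩ := hμ
  have hk : cfc (fun t : ℝ => t - t * t) Q = Q - Q * Q := by
    rw [cfc_sub (fun t => t) (fun t => t * t) Q, cfc_mul (fun t => t) (fun t => t) Q,
      cfc_id' ℝ Q]
  rw [← hk] at hn
  -- By concavity, $t-t^2$ on $[\mu,(1+\mu)/2]$ is bounded below by its endpoint values $\mu(1-\mu)$
  -- and $(1+\mu)(1-\mu)/4$, both at least $\mu(1-\mu)/2$.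
  have hfin := hn.finite_spectrum hQ (by fun_prop) (δ := μ * (1 - μ) / 2)
    (by have : 0 < 1 - μ := by linarith
        positivity)
  have hsub : spectrum ℝ Q ∩ Set.Icc μ ((1 + μ) / 2) ⊆
      {t ∈ spectrum ℝ Q | μ * (1 - μ) / 2 ≤ t - t * t} := by
    rintro t ⟨ht, h2, h3⟩
    exact ⟨ht, by nlinarith⟩
  obtain ⟨c, hc1, hc2, hc⟩ := exists_gap_of_finite (by linarith) (hfin.subset hsub)
  exact ⟨c, hc1, by linarith, hc⟩

theorem IsNuclear.sub_specFlatten {Q : H →L[ℂ] H} (hQ : IsSelfAdjoint Q)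
    (hn : IsNuclear.{w} (Q - Q * Q)) {μ : ℝ} (hμ : μ ∈ Set.Ioo (0 : ℝ) 1) :
    IsNuclear.{w} (Q - specFlatten μ Q) := by
  obtain ⟨c, hμc, hc1, hgap⟩ := hn.exists_spectral_gap hQ hμ
  have hstep := continuous_stepFun μ c
  rw [specFlatten_eq_cfc hQ hμc hgap]
  -- Below the gap $t=(t-t^2)/(1-t)$, and above it $t-1=-(t-t^2)/t$. The truncations `min t μ` and
  -- `max t c` keep the denominators away from zero.
  let g : ℝ → ℝ := fun t =>
    (1 - stepFun μ c t) / (1 - min t μ) - stepFun μ c t / max t c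
  have hg : Continuous g := by
    refine Continuous.sub (Continuous.div (by fun_prop) (by fun_prop) fun t => ?_)
      (Continuous.div (by fun_prop) (by fun_prop) fun t => ?_)
    · have := min_le_right t μ
      linarith [hμ.2]
    · have := le_max_right t c
      linarith [hμ.1]
  have : Q - cfc (stepFun μ c) Q = (Q - Q * Q) * cfc g Q := by
    have h1 : Q - Q * Q = cfc (fun t : ℝ => t - t * t) Q := by
      rw [cfc_sub (fun t => t) (fun t => t * t) Q, cfc_mul (fun t => t) (fun t => t) Q,
        cfc_id' ℝ Q]
    rw [h1, ← cfc_mul _ _ Q (by fun_prop) hg.continuousOn]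
    nth_rewrite 1 [← cfc_id' ℝ Q]
    rw [← cfc_sub (fun t => t) _ Q (by fun_prop) hstep.continuousOn]
    refine cfc_congr fun t ht => ?_
    rcases hgap t ht with h | h
    · simp only [g, stepFun_of_le hμc h, min_eq_left h]
      have : 1 - t ≠ 0 := by linarith [hμ.2]
      field_simp
      ring
    · simp only [g, stepFun_of_ge hμc h, max_eq_left h]
      have : t ≠ 0 := by linarith [hμ.1]
      field_simp
      ring
  rw [this]
  exact hn.mul_right _

end Flattening

/-! ### Kramers degeneracy and pairs of projections. -/

section ProjectionPairs

universe w

variable {ι H : Type*} [NormedAddCommGroup H] [InnerProductSpace ℂ H] [CompleteSpace H]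

open Filter Topology

/-- Polarization: antilinearity exchanges the two norms $\|x\pm iy\|$, which flips the imaginary
part. -/
theorem LinearIsometryEquiv.inner_map_map_conj (T : H ≃ₛₗᵢ[starRingEnd ℂ] H) (x y : H) :
    inner ℂ (T x) (T y) = conj (inner ℂ x y) := by
  have h (c : ℂ) : ‖T x + c • T y‖ = ‖x + conj c • y‖ := by
    rw [← T.norm_map (x + conj c • y), map_add, T.map_smulₛₗ, Complex.conj_conj]
  have h1 := h 1
  have h2 := h (-1)
  have h3 := h Complex.I
  have h4 := h (-Complex.I)
  simp only [map_one, map_neg, one_smul, neg_smul, Complex.conj_I, neg_neg, ← sub_eq_add_neg]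
    at h1 h2 h3 h4
  have e (z w : H) : inner ℂ z w = (((‖z + w‖ ^ 2 - ‖z - w‖ ^ 2) / 4 : ℝ) : ℂ) +
      (((‖z - Complex.I • w‖ ^ 2 - ‖z + Complex.I • w‖ ^ 2) / 4 : ℝ) : ℂ) * Complex.I := by
    refine (inner_eq_sum_norm_sq_div_four z w).trans ?_
    push_cast
    simp only [RCLike.I_to_complex, Complex.coe_algebraMap]
    ring
  have hpq (p q q' : ℝ) (h : q = -q') :
      (p : ℂ) + q * Complex.I = conj ((p : ℂ) + q' * Complex.I) := by
    simp [h]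
  rw [e, e, h1, h2, h3, h4]
  exact hpq _ _ _ (by ring)

/-- Conjugation by an antiunitary operator, as a real-linear star homomorphism. -/
def LinearIsometryEquiv.conjAntiunitary (T : H ≃ₛₗᵢ[starRingEnd ℂ] H) :
    (H →L[ℂ] H) →⋆ₐ[ℝ] (H →L[ℂ] H) where
  toFun A := (T.toContinuousLinearEquiv : H →SL[starRingEnd ℂ] H).comp
    (A.comp (T.symm.toContinuousLinearEquiv : H →SL[starRingEnd ℂ] H))
  map_one' := by ext v; simp
  map_mul' A B := by ext v; simp
  map_zero' := by ext v; simp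
  map_add' A B := by ext v; simp
  commutes' r := by
    ext v
    have h : (algebraMap ℝ (H →L[ℂ] H) r) = (r : ℂ) • (1 : H →L[ℂ] H) := by
      rw [Algebra.algebraMap_eq_smul_one, Complex.coe_smul]
    rw [h]
    change T ((r : ℂ) • T.symm v) = (r : ℂ) • v
    rw [T.map_smulₛₗ, Complex.conj_ofReal, T.apply_symm_apply]
  map_star' A := by
    rw [ContinuousLinearMap.star_eq_adjoint, ContinuousLinearMap.star_eq_adjoint,
      ContinuousLinearMap.eq_adjoint_iff]
    intro x y
    obtain ⟨x, rfl⟩ := T.surjective x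
    obtain ⟨y, rfl⟩ := T.surjective y
    simp [LinearIsometryEquiv.inner_map_map_conj, ContinuousLinearMap.adjoint_inner_left]

@[simp]
theorem LinearIsometryEquiv.conjAntiunitary_apply (T : H ≃ₛₗᵢ[starRingEnd ℂ] H) (A : H →L[ℂ] H)
    (v : H) : T.conjAntiunitary A v = T (A (T.symm v)) := rfl

theorem LinearIsometryEquiv.continuous_conjAntiunitary (T : H ≃ₛₗᵢ[starRingEnd ℂ] H) :
    Continuous T.conjAntiunitary := by
  refine (T.conjAntiunitary.toAlgHom.toLinearMap.mkContinuous 1 fun A => ?_).continuous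
  rw [one_mul]
  refine ContinuousLinearMap.opNorm_le_bound _ (norm_nonneg _) fun v => ?_
  change ‖T (A (T.symm v))‖ ≤ _
  rw [T.norm_map]
  simpa using A.le_opNorm (T.symm v)

/-- Conjugation by $T$ is a continuous real star homomorphism fixing $A$. It therefore fixes $f(A)$
for real $f$, although it is not complex linear. -/
theorem LinearIsometryEquiv.apply_cfc_of_commute (T : H ≃ₛₗᵢ[starRingEnd ℂ] H) {A : H →L[ℂ] H}
    (hA : IsSelfAdjoint A) {f : ℝ → ℝ} (hf : Continuous f) (hT : ∀ v, T (A v) = A (T v)) (v : H) :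
    T (cfc f A v) = cfc f A (T v) := by
  have h1 : T.conjAntiunitary A = A := by
    ext v
    simp [hT]
  have h2 := StarAlgHomClass.map_cfc T.conjAntiunitary f A hf.continuousOn
    T.continuous_conjAntiunitary hA (h1.symm ▸ hA)
  rw [h1] at h2
  simpa using congr($h2 (T v))

/-- A unitary matrix of an antiunitary map with square `-1` has even size. -/
theorem even_card_of_mul_conj_eq_neg_one {n : Type*} [Fintype n] [DecidableEq n]
    (U : Matrix n n ℂ) (h : U * U.map conj = -1) : Even (Fintype.card n) := by
  -- Determinants give $|\det U|^2=(-1)^n$, which rules out odd $n$.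
  have h1 : U.det * conj U.det = (-1) ^ Fintype.card n := by
    have h2 : (U.map conj).det = conj U.det := (RingHom.map_det (starRingEnd ℂ) U).symm
    rw [← h2, ← Matrix.det_mul, h, Matrix.det_neg, Matrix.det_one, mul_one]
  by_contra hodd
  rw [Nat.not_even_iff_odd] at hodd
  rw [hodd.neg_one_pow, Complex.mul_conj] at h1
  have h3 : Complex.normSq U.det = -1 := by exact_mod_cast h1
  linarith [Complex.normSq_nonneg U.det]

/-- A nuclear projection that commutes with an antiunitary operator of square `-1` has an even
trace. -/
theorem IsNuclear.opTrace_projection_even (b : HilbertBasis ι ℂ H) {F : H →L[ℂ] H}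
    (hn : IsNuclear.{w} F) (hF : IsStarProjection F) (T : H ≃ₛₗᵢ[starRingEnd ℂ] H)
    (hT : ∀ v, T (T v) = -v) (hTF : ∀ v, T (F v) = F (T v)) :
    ∃ k : ℤ, opTrace b F = 2 * k := by
  have hFF (v : H) : F (F v) = F v := congr($(hF.isIdempotentElem.eq) v)
  let K : Submodule ℂ H := LinearMap.ker (F - 1).toLinearMap
  have hK (v : H) : v ∈ K ↔ F v = v := by
    change F v - v = 0 ↔ _
    exact sub_eq_zero
  have hKc : IsClosed (K : Set H) := (F - 1).isClosed_ker
  have : CompleteSpace K := hKc.completeSpace_coe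
  obtain ⟨s, e', he'⟩ := exists_hilbertBasis ℂ K
  let e : s → H := fun i => (e' i : H)
  have he : Orthonormal ℂ e := e'.orthonormal.comp_linearIsometry K.subtypeₗᵢ
  have hFe (i : s) : F (e i) = e i := (hK _).1 (e' i).2
  obtain ⟨κ, u, v, hn⟩ := hn
  -- Each basis vector of the range contributes $1$ to the diagonal of $F$, so the nuclear bound
  -- limits their number.
  have hfin : Finite s := by
    by_contra hinf
    rw [not_finite_iff_infinite] at hinf
    obtain ⟨n, hN⟩ := exists_nat_gt (∑' k, ‖u k‖ * ‖v k‖)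
    obtain ⟨t, ht⟩ := Infinite.exists_subset_card_eq s n
    have := hn.sum_norm_inner_le he t
    simp only [hFe, inner_self_eq_norm_sq_to_K, he.1] at this
    simp [ht] at this
    linarith
  have := Fintype.ofFinite s
  have hexp (x y : H) (hy : F y = y) :
      HasSum (fun i => inner ℂ x (e i) * inner ℂ (e i) y) (inner ℂ x y) := by
    have h1 := e'.hasSum_inner_mul_inner (K.orthogonalProjectionOnto x) ⟨y, (hK y).2 hy⟩
    simpa [e] using h1
  have hrep : NuclearRep e e F := by
    refine ⟨summable_of_hasFiniteSupport (Set.toFinite _), fun x y => ?_⟩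
    have h1 := hexp x (F y) (hFF y)
    have h2 (i : s) : inner ℂ (e i) (F y) = inner ℂ (e i) y := by
      rw [← hF.isSelfAdjoint.inner_apply_comm, hFe]
    simpa [h2] using h1
  have htr : opTrace b F = Fintype.card s := by
    rw [hrep.opTrace_eq b]
    simp [inner_self_eq_norm_sq_to_K, he.1]
  classical
  have heven : Even (Fintype.card s) := by
    -- The matrix of $T$ on the range of $F$. Antilinearity conjugates the second factor, so
    -- $T^2=-1$ reads $U\overline U=-1$.
    let U : Matrix s s ℂ := fun i j => inner ℂ (e i) (T (e j))
    refine even_card_of_mul_conj_eq_neg_one U ?_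
    ext i j
    have h1 : T (e j) = ∑ k, inner ℂ (e k) (T (e j)) • e k := by
      refine ext_inner_left ℂ fun x => ?_
      have := (hexp x (T (e j)) (by rw [← hTF, hFe])).tsum_eq
      rw [← this, tsum_fintype, inner_sum]
      refine Finset.sum_congr rfl fun k _ => ?_
      rw [inner_smul_right, mul_comm]
    have h2 : inner ℂ (e i) (T (T (e j))) = ∑ k, U i k * conj (U k j) := by
      conv_lhs => rw [h1, map_sum, inner_sum]
      refine Finset.sum_congr rfl fun k _ => ?_
      rw [LinearIsometryEquiv.map_smulₛₗ, inner_smul_right, mul_comm]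
    rw [Matrix.mul_apply]
    simp only [Matrix.map_apply]
    rw [← h2, hT, inner_neg_right, orthonormal_iff_ite.1 he, Matrix.neg_apply, Matrix.one_apply]
  obtain ⟨k, hk⟩ := heven
  exact ⟨k, by rw [htr, hk]; push_cast; ring⟩

/-- The spectral projection at `1` of a nuclear self-adjoint operator, by continuous functional
calculus. -/
theorem IsNuclear.exists_eigenprojection_one {S : H →L[ℂ] H} (hS : IsSelfAdjoint S)
    (hn : IsNuclear.{w} S) :
    ∃ f θ : ℝ → ℝ, Continuous f ∧ cfc f S = 1 - cfc θ S * (1 - S) ∧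
      cfc f S * cfc f S = cfc f S ∧ S * cfc f S = cfc f S := by
  have hfin := (show IsNuclear.{w} (cfc (fun t : ℝ => t) S) by
    rwa [cfc_id' ℝ S]).finite_spectrum hS continuous_id' (δ := 1 / 2) (by norm_num)
  obtain ⟨δ, hδ, hgap⟩ : ∃ δ > 0, ∀ t ∈ spectrum ℝ S, t = 1 ∨ δ ≤ |1 - t| := by
    have h1 : ({t ∈ spectrum ℝ S | 1 / 2 ≤ t} \ {1})ᶜ ∈ 𝓝 (1 : ℝ) :=
      hfin.sdiff.isClosed.isOpen_compl.mem_nhds (by simp)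
    obtain ⟨ε, hε, h3⟩ := Metric.mem_nhds_iff.1 h1
    refine ⟨min ε (1 / 2), lt_min hε (by norm_num), fun t ht => ?_⟩
    by_contra! hcon
    obtain ⟨hne, hlt⟩ := hcon
    refine @h3 t ?_ ⟨⟨ht, ?_⟩, hne⟩
    · rw [Metric.mem_ball, dist_comm, Real.dist_eq]
      exact hlt.trans_le (min_le_left _ _)
    · have := (le_abs_self (1 - t)).trans (hlt.le.trans (min_le_right _ _))
      linarith
  -- A continuous truncation of $1/(1-t)$, exact at spectral points other than $1$. As $1$ is
  -- isolated from the rest of the spectrum, $f$ is the indicator of $\{1\}$ there.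
  let θ : ℝ → ℝ := fun t => (1 - t) / max ((1 - t) ^ 2) (δ ^ 2)
  have hθ : Continuous θ := by
    refine Continuous.div (by fun_prop) (by fun_prop) fun t => ?_
    exact (lt_of_lt_of_le (by positivity) (le_max_right ((1 - t) ^ 2) (δ ^ 2))).ne'
  let f : ℝ → ℝ := fun t => 1 - (1 - t) * θ t
  have hf : Continuous f := by fun_prop
  have hf01 : ∀ t ∈ spectrum ℝ S, f t = 0 ∨ (f t = 1 ∧ t = 1) := by
    intro t ht
    rcases hgap t ht with h | h
    · right
      simp [f, h]
    · left
      have h1 : δ ^ 2 ≤ (1 - t) ^ 2 := by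
        rw [← sq_abs (1 - t)]
        gcongr
      have h2 : 1 - t ≠ 0 := by
        intro h0
        rw [h0, abs_zero] at h
        linarith
      simp only [f, θ, max_eq_left h1]
      field_simp
      ring
  refine ⟨f, θ, hf, ?_, ?_, ?_⟩
  · have h1 : 1 - S = cfc (fun t : ℝ => 1 - t) S := by
      rw [cfc_sub (fun _ => (1 : ℝ)) (fun t => t) S, cfc_const_one ℝ S, cfc_id' ℝ S]
    rw [h1, ← cfc_mul _ _ S hθ.continuousOn (by fun_prop), ← cfc_const_one ℝ S,
      ← cfc_sub _ _ S (by fun_prop) (by fun_prop)]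
    refine cfc_congr fun t _ => ?_
    simp only [f]
    ring
  · rw [← cfc_mul _ _ _ hf.continuousOn hf.continuousOn]
    refine cfc_congr fun t ht => ?_
    rcases hf01 t ht with h | h
    · simp [h]
    · simp [h.1]
  · nth_rewrite 1 [← cfc_id' ℝ S]
    rw [← cfc_mul _ _ _ (by fun_prop) hf.continuousOn]
    refine cfc_congr fun t ht => ?_
    rcases hf01 t ht with h | h
    · simp [h]
    · simp [h.2]

/-- For two projections with nuclear difference that commute with an antiunitary operator of
square `-1`, the trace of the difference is an even integer. -/
theorem opTrace_sub_projections_even (b : HilbertBasis ι ℂ H) {E₁ E₂ : H →L[ℂ] H}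
    (h₁ : IsStarProjection E₁) (h₂ : IsStarProjection E₂) (hn : IsNuclear.{w} (E₁ - E₂))
    (T : H ≃ₛₗᵢ[starRingEnd ℂ] H) (hT : ∀ v, T (T v) = -v)
    (hT₁ : ∀ v, T (E₁ v) = E₁ (T v)) (hT₂ : ∀ v, T (E₂ v) = E₂ (T v)) :
    ∃ k : ℤ, opTrace b (E₁ - E₂) = 2 * k := by
  obtain ⟨A, hA⟩ : ∃ A, A = E₁ - E₂ := ⟨_, rfl⟩
  obtain ⟨B, hB⟩ : ∃ B, B = 1 - E₁ - E₂ := ⟨_, rfl⟩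
  have e₁ := h₁.isIdempotentElem.eq
  have e₂ := h₂.isIdempotentElem.eq
  have hAB : A * B = -(B * A) := by
    rw [hA, hB]
    simp only [sub_mul, mul_sub, one_mul, mul_one, e₁, e₂]
    abel
  have hsq : A * A + B * B = 1 := by
    rw [hA, hB]
    simp only [sub_mul, mul_sub, one_mul, mul_one, e₁, e₂]
    abel
  have hAs : IsSelfAdjoint A := hA ▸ h₁.isSelfAdjoint.sub h₂.isSelfAdjoint
  rw [← hA] at hn ⊢
  have hAAs : IsSelfAdjoint (A * A) := by simpa [hAs.star_eq] using IsSelfAdjoint.star_mul_self A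
  have hTA (v : H) : T (A v) = A (T v) := by
    simp [hA, hT₁, hT₂]
  have hBA : Commute (A * A) B := by
    change A * A * B = B * (A * A)
    rw [mul_assoc, hAB, mul_neg, ← mul_assoc, hAB, neg_mul, neg_neg, mul_assoc]
  obtain ⟨f, θ, hf, hFX, hFF, hAAF⟩ := (hn.mul_left A).exists_eigenprojection_one hAAs
  have hXA : Commute (cfc θ (A * A)) A := Commute.cfc_real (Commute.mul_left rfl rfl) θ
  have hXB : Commute (cfc θ (A * A)) B := Commute.cfc_real hBA θ
  have hFA : Commute (cfc f (A * A)) A := Commute.cfc_real (Commute.mul_left rfl rfl) f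
  have hFs : IsSelfAdjoint (cfc f (A * A)) := IsSelfAdjoint.cfc
  have hTF := T.apply_cfc_of_commute hAAs hf (fun v => by simp [hTA])
  rw [show 1 - A * A = B * B by rw [← hsq]; abel] at hFX
  generalize cfc f (A * A) = F at *
  generalize cfc θ (A * A) = X at *
  -- This splits $A=AF+(XAB)B$, where $F$ projects onto the eigenspace $A^2=1$.
  have hAF : A * F = A - X * A * B * B := by
    rw [hFX, mul_sub, mul_one, ← mul_assoc, ← mul_assoc, hXA.eq]
  have hXAB : IsNuclear.{w} (X * A * B) := (hn.mul_left X).mul_right B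
  -- $B$ anticommutes with $XA$, so cyclicity equates this trace with its negative.
  have htr0 : opTrace b (X * A * B * B) = 0 := by
    have h1 : B * (X * A * B) = -(X * A * B * B) := by
      have h2 : B * (X * A) = -(X * A * B) := by
        rw [← mul_assoc, ← hXB.eq, mul_assoc, mul_assoc, hAB, mul_neg, neg_neg]
      rw [← mul_assoc, h2, neg_mul]
    have h3 := hXAB.opTrace_mul_comm b B
    rw [h1] at h3
    have h4 : opTrace b (-(X * A * B * B)) = -opTrace b (X * A * B * B) := by
      simp only [opTrace, matEntry, neg_apply, inner_neg_right]
      exact tsum_neg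
    rw [h4] at h3
    exact self_eq_neg.1 h3
  have hnF : IsNuclear.{w} F := by
    rw [← hAAF]
    exact (hn.mul_left A).mul_right F
  -- The operators $(F\pm AF)/2$ are the eigenprojections of $A$ at $\pm1$. They are $T$-invariant
  -- because the coefficients are real.
  have key (c : ℂ) (hc : c = 1 ∨ c = -1) (hcT : ∀ v : H, T (c • v) = c • T v) :
      ∃ k : ℤ, opTrace b ((2 : ℂ)⁻¹ • (F + c • (A * F))) = 2 * k := by
    have hcc : c * c = 1 := by rcases hc with rfl | rfl <;> norm_num
    have hcs : star c = c := by rcases hc with rfl | rfl <;> simp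
    have h2T (v : H) : T ((2 : ℂ)⁻¹ • v) = (2 : ℂ)⁻¹ • T v := by
      rw [LinearIsometryEquiv.map_smulₛₗ, map_inv₀, map_ofNat]
    have hAFs : IsSelfAdjoint (A * F) := by
      rw [IsSelfAdjoint, star_mul, hAs.star_eq, hFs.star_eq, hFA.eq]
    refine IsNuclear.opTrace_projection_even b
      ((hnF.add ((hn.mul_right F).smul c)).smul _) ⟨?_, ?_⟩ T hT fun v => ?_
    · have h1 : F * (A * F) = A * F := by rw [← mul_assoc, hFA.eq, mul_assoc, hFF]
      have h2 : A * F * F = A * F := by rw [mul_assoc, hFF]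
      have h3 : A * F * (A * F) = F := by rw [mul_assoc, h1, ← mul_assoc, hAAF]
      rw [IsIdempotentElem, smul_mul_smul_comm, add_mul, mul_add, mul_add, hFF,
        mul_smul_comm, smul_mul_assoc, smul_mul_smul_comm, h1, h2, h3, hcc]
      module
    · rw [IsSelfAdjoint, star_smul, star_add, star_smul, hAFs.star_eq, hFs.star_eq, hcs]
      simp
    · simp only [smul_apply, add_apply, h2T, map_add, hcT, hTF]
      congr 3
      change T (A (F v)) = A (F (T v))
      rw [hTA, hTF]
  obtain ⟨k₁, hk₁⟩ := key 1 (Or.inl rfl) (by simp)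
  obtain ⟨k₂, hk₂⟩ := key (-1) (Or.inr rfl) (by simp)
  have hnAF : IsNuclear.{w} (A * F) := hn.mul_right F
  have hn1 (c : ℂ) : IsNuclear.{w} ((2 : ℂ)⁻¹ • (F + c • (A * F))) :=
    (hnF.add (hnAF.smul c)).smul _
  refine ⟨k₁ - k₂, ?_⟩
  have h5 : A = ((2 : ℂ)⁻¹ • (F + (1 : ℂ) • (A * F)) - (2 : ℂ)⁻¹ • (F + (-1 : ℂ) • (A * F)))
      + X * A * B * B := by
    have h6 : A = A * F + X * A * B * B := by rw [hAF]; abel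
    conv_lhs => rw [h6]
    congr 1
    module
  rw [h5, opTrace_add (((hn1 1).sub (hn1 (-1))).summable_matEntry b)
    ((hXAB.mul_right B).summable_matEntry b), opTrace_sub ((hn1 1).summable_matEntry b)
    ((hn1 (-1)).summable_matEntry b), htr0, hk₁, hk₂]
  push_cast
  ring

end ProjectionPairs

/-! ### Gauge transformations and invariance of the vertex trace. -/

section Gauge

universe w

variable {ι H : Type*} [NormedAddCommGroup H] [InnerProductSpace ℂ H] [CompleteSpace H]

/-- Phases of the basis vectors define a unitary operator. -/
theorem HilbertBasis.exists_gauge (b : HilbertBasis ι ℂ H) (a : ι → ℂ) (ha : ∀ x, ‖a x‖ = 1) :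
    ∃ G : H ≃ₗᵢ[ℂ] H, ∀ x, G (b x) = a x • b x := by
  have ho : Orthonormal ℂ fun x => a x • b x := by
    refine ⟨fun x => by rw [norm_smul, ha, b.orthonormal.1, one_mul], fun x y hxy => ?_⟩
    change inner ℂ (a x • b x) (a y • b y) = 0
    rw [inner_smul_left, inner_smul_right, b.orthonormal.2 hxy, mul_zero, mul_zero]
  have hspan : ⊤ ≤ (Submodule.span ℂ (Set.range fun x => a x • b x)).topologicalClosure := by
    rw [← b.dense_span]
    refine Submodule.topologicalClosure_mono (Submodule.span_le.2 ?_)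
    rintro _ ⟨x, rfl⟩
    have h0 : a x ≠ 0 := norm_ne_zero_iff.1 (by rw [ha]; exact one_ne_zero)
    have : b x = (a x)⁻¹ • (a x • b x) := by rw [smul_smul, inv_mul_cancel₀ h0, one_smul]
    rw [SetLike.mem_coe, this]
    exact Submodule.smul_mem _ _ (Submodule.subset_span ⟨x, rfl⟩)
  classical
  refine ⟨b.repr.trans (HilbertBasis.mk ho hspan).repr.symm, fun x => ?_⟩
  rw [LinearIsometryEquiv.trans_apply, b.repr_self, HilbertBasis.repr_symm_single,
    HilbertBasis.coe_mk]

theorem matEntry_conj_gauge {b : HilbertBasis ι ℂ H} {a : ι → ℂ} (ha : ∀ x, ‖a x‖ = 1)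
    {G : H ≃ₗᵢ[ℂ] H} (hG : ∀ x, G (b x) = a x • b x) (A : H →L[ℂ] H) (x y : ι) :
    matEntry b (G.conjStarAlgEquiv A) x y = a x * conj (a y) * matEntry b A x y := by
  have h1 (z : ι) : G.symm (b z) = conj (a z) • b z := by
    rw [LinearIsometryEquiv.symm_apply_eq, map_smul, hG, smul_smul, mul_comm, Complex.mul_conj,
      Complex.normSq_eq_norm_sq, ha]
    simp
  have h2 : inner ℂ (b x) (G (A (G.symm (b y)))) = inner ℂ (G.symm (b x)) (A (G.symm (b y))) := by
    rw [← G.inner_map_map (G.symm (b x)), G.apply_symm_apply]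
  rw [matEntry, LinearIsometryEquiv.conjStarAlgEquiv_apply_apply, h2, h1, h1, map_smul,
    inner_smul_left, inner_smul_right, Complex.conj_conj, matEntry]
  ring

theorem IsNuclear.conj {A : H →L[ℂ] H} (hA : IsNuclear.{w} A) (G : H ≃ₗᵢ[ℂ] H) :
    IsNuclear.{w} (G.conjStarAlgEquiv A) := by
  have : G.conjStarAlgEquiv A = (G : H →L[ℂ] H) * A * (G.symm : H →L[ℂ] H) := by
    ext v
    rfl
  rw [this]
  exact (hA.mul_left _).mul_right _

theorem IsSelfAdjoint.conj_gauge {A : H →L[ℂ] H} (hA : IsSelfAdjoint A) (G : H ≃ₗᵢ[ℂ] H) :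
    IsSelfAdjoint (G.conjStarAlgEquiv A) := hA.map G.conjStarAlgEquiv

theorem LinearIsometryEquiv.continuous_conjStarAlgEquiv (G : H ≃ₗᵢ[ℂ] H) :
    Continuous (G.conjStarAlgEquiv : (H →L[ℂ] H) → H →L[ℂ] H) := by
  have : (G.conjStarAlgEquiv : (H →L[ℂ] H) → H →L[ℂ] H) =
      fun A => (G : H →L[ℂ] H) * A * (G.symm : H →L[ℂ] H) := rfl
  rw [this]
  fun_prop

theorem conj_specFlatten {Q : H →L[ℂ] H} (hQ : IsSelfAdjoint Q)
    (hn : IsNuclear.{w} (Q - Q * Q)) {μ : ℝ} (hμ : μ ∈ Set.Ioo (0 : ℝ) 1) (G : H ≃ₗᵢ[ℂ] H) :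
    G.conjStarAlgEquiv (specFlatten μ Q) = specFlatten μ (G.conjStarAlgEquiv Q) := by
  have hn' := hn.conj G
  rw [map_sub, map_mul] at hn'
  obtain ⟨c, h1, -, h2⟩ := hn.exists_spectral_gap hQ hμ
  obtain ⟨c', h1', -, h2'⟩ := hn'.exists_spectral_gap (hQ.conj_gauge G) hμ
  -- The smaller of the two gap endpoints lets one step function compute both flattenings.
  rw [specFlatten_eq_cfc hQ (lt_min h1 h1') fun t ht =>
      (h2 t ht).imp_right (min_le_left c c').trans,
    specFlatten_eq_cfc (hQ.conj_gauge G) (lt_min h1 h1') fun t ht =>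
      (h2' t ht).imp_right (min_le_right c c').trans]
  exact StarAlgHomClass.map_cfc (S := ℂ) G.conjStarAlgEquiv _ Q
    (continuous_stepFun _ _).continuousOn G.continuous_conjStarAlgEquiv hQ (hQ.conj_gauge G)

/-- Gauge transformations do not change the trace over vertex states. -/
theorem vertexTrace_conj_gauge {b : HilbertBasis ι ℂ H} {a : ι → ℂ} (ha : ∀ x, ‖a x‖ = 1)
    {G : H ≃ₗᵢ[ℂ] H} (hG : ∀ x, G (b x) = a x • b x) {Q : H →L[ℂ] H} (hQ : IsSelfAdjoint Q)
    (hn : IsNuclear.{w} (Q - Q * Q)) {μ : ℝ} (hμ : μ ∈ Set.Ioo (0 : ℝ) 1) :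
    vertexTrace b μ (G.conjStarAlgEquiv Q) = vertexTrace b μ Q := by
  rw [vertexTrace, ← conj_specFlatten hQ hn hμ, ← map_sub, vertexTrace, opTrace, opTrace]
  refine tsum_congr fun x => ?_
  rw [matEntry_conj_gauge ha hG, Complex.mul_conj, Complex.normSq_eq_norm_sq, ha]
  simp

theorem LinearIsometryEquiv.apply_specFlatten_of_commute (T : H ≃ₛₗᵢ[starRingEnd ℂ] H)
    {Q : H →L[ℂ] H} (hQ : IsSelfAdjoint Q) (hn : IsNuclear.{w} (Q - Q * Q)) {μ : ℝ}
    (hμ : μ ∈ Set.Ioo (0 : ℝ) 1) (hT : ∀ v, T (Q v) = Q (T v)) (v : H) :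
    T (specFlatten μ Q v) = specFlatten μ Q (T v) := by
  obtain ⟨c, h1, -, h2⟩ := hn.exists_spectral_gap hQ hμ
  rw [specFlatten_eq_cfc hQ h1 h2]
  exact T.apply_cfc_of_commute hQ (continuous_stepFun _ _) hT v

/-- Two operators with the same diagonal, a nuclear difference and the same time reversal symmetry
have the same trace over vertex states modulo two. -/
theorem vertexTrace_sub_even (b : HilbertBasis ι ℂ H) {Q₁ Q₂ : H →L[ℂ] H}
    (h₁ : IsSelfAdjoint Q₁) (h₂ : IsSelfAdjoint Q₂)
    (hn₁ : IsNuclear.{w} (Q₁ - Q₁ * Q₁)) (hn₂ : IsNuclear.{w} (Q₂ - Q₂ * Q₂))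
    (hn : IsNuclear.{w} (Q₁ - Q₂)) (hdiag : ∀ x, matEntry b Q₁ x x = matEntry b Q₂ x x)
    (T : H ≃ₛₗᵢ[starRingEnd ℂ] H) (hT : ∀ v, T (T v) = -v)
    (hT₁ : ∀ v, T (Q₁ v) = Q₁ (T v)) (hT₂ : ∀ v, T (Q₂ v) = Q₂ (T v))
    {μ₁ μ₂ : ℝ} (hμ₁ : μ₁ ∈ Set.Ioo (0 : ℝ) 1) (hμ₂ : μ₂ ∈ Set.Ioo (0 : ℝ) 1) :
    ∃ k : ℤ, vertexTrace b μ₁ Q₁ - vertexTrace b μ₂ Q₂ = 2 * k := by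
  have hf₁ := hn₁.sub_specFlatten h₁ hμ₁
  have hf₂ := hn₂.sub_specFlatten h₂ hμ₂
  have hE : IsNuclear.{w} (specFlatten μ₁ Q₁ - specFlatten μ₂ Q₂) := by
    have := (hn.sub hf₁).add hf₂
    convert this using 1
    abel
  obtain ⟨k, hk⟩ := opTrace_sub_projections_even b (isStarProjection_specFlatten μ₁ Q₁)
    (isStarProjection_specFlatten μ₂ Q₂) hE T hT
    (T.apply_specFlatten_of_commute h₁ hn₁ hμ₁ hT₁) (T.apply_specFlatten_of_commute h₂ hn₂ hμ₂ hT₂)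
  refine ⟨-k, ?_⟩
  -- The diagonals of $Q_1$ and $Q_2$ cancel entry by entry, leaving only the flattened projections.
  have h3 : vertexTrace b μ₁ Q₁ - vertexTrace b μ₂ Q₂
      = -opTrace b (specFlatten μ₁ Q₁ - specFlatten μ₂ Q₂) := by
    rw [vertexTrace, vertexTrace,
      ← opTrace_sub (hf₁.summable_matEntry b) (hf₂.summable_matEntry b), opTrace, opTrace,
      ← tsum_neg]
    refine tsum_congr fun x => ?_
    simp only [matEntry_sub, hdiag]
    ring
  rw [h3, hk]
  push_cast
  ring

end Gauge

/-! ### Entrywise twists of the projection. -/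

section Twist

variable {ι H : Type*} [NormedAddCommGroup H] [InnerProductSpace ℂ H] [CompleteSpace H]
  {b : HilbertBasis ι ℂ H} {pos : ι → ℂ} {s : ℂ → ℂ → ℂ} {P Q : H →L[ℂ] H}

theorem IsTwistOf.isSelfAdjoint (hQ : IsTwistOf b pos s P Q) (hP : IsSelfAdjoint P)
    (hs : ∀ x y, s (pos y) (pos x) = conj (s (pos x) (pos y))) : IsSelfAdjoint Q := by
  refine ContinuousLinearMap.ext_matEntry b fun x y => ?_
  rw [matEntry_adjoint, hQ, hQ, map_mul, ← hs, ← matEntry_adjoint, hP.star_eq]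

/-- A twist by real on-site signs preserves time reversal symmetry. -/
theorem IsTimeReversal.apply_twist {T : H ≃ₛₗᵢ[starRingEnd ℂ] H} (hT : IsTimeReversal b pos T)
    (hTP : ∀ v, T (P v) = P (T v)) (hQ : IsTwistOf b pos s P Q)
    (hs : ∀ x y, conj (s (pos x) (pos y)) = s (pos x) (pos y)) (v : H) :
    T (Q v) = Q (T v) := by
  -- Because $T$ is on-site, expanding $T^{-1}b_x$ or $Tb_y$ involves only orbitals at the position
  -- of $x$ or $y$. The sign is constant along either sum, and being real it passes through $T$.
  have key (x y : ι) : inner ℂ (b x) (T (Q (b y))) = inner ℂ (b x) (Q (T (b y))) := by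
    have hL : inner ℂ (b x) (T (Q (b y)))
        = s (pos x) (pos y) * inner ℂ (b x) (T (P (b y))) := by
      have h1 (z : H) : inner ℂ (b x) (T z) = conj (inner ℂ (T.symm (b x)) z) := by
        rw [← T.inner_map_map_conj, T.apply_symm_apply]
      have h2 := b.hasSum_inner_mul_inner (T.symm (b x)) (Q (b y))
      have h3 := (b.hasSum_inner_mul_inner (T.symm (b x)) (P (b y))).mul_left
        (s (pos x) (pos y))
      rw [h1, h1, ← hs x y, ← map_mul]
      congr 1
      refine h2.unique ?_
      convert! h3 using 1
      ext z
      have h4 := hQ z y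
      rw [matEntry, matEntry] at h4
      by_cases hz : pos x = pos z
      · rw [h4, hz]
        ring
      · have h5 := hT.onsite x z hz
        rw [h1, map_eq_zero] at h5
        simp [h5]
    have hR : inner ℂ (b x) (Q (T (b y)))
        = s (pos x) (pos y) * inner ℂ (b x) (P (T (b y))) := by
      have h2 := b.hasSum_inner_mul_inner (ContinuousLinearMap.adjoint Q (b x)) (T (b y))
      have h3 := (b.hasSum_inner_mul_inner (ContinuousLinearMap.adjoint P (b x)) (T (b y))).mul_left
        (s (pos x) (pos y))
      simp only [ContinuousLinearMap.adjoint_inner_left] at h2 h3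
      refine h2.unique ?_
      convert! h3 using 1
      ext z
      have h4 := hQ x z
      rw [matEntry, matEntry] at h4
      by_cases hz : pos z = pos y
      · rw [h4, hz]
        ring
      · simp [hT.onsite z y hz]
    rw [hL, hR, hTP]
  have hb (y : ι) : T (Q (b y)) = Q (T (b y)) := by
    refine b.repr.injective (Subtype.ext (funext fun x => ?_))
    rw [b.repr_apply_apply, b.repr_apply_apply]
    exact key x y
  let T' : H →SL[starRingEnd ℂ] H := T.toContinuousLinearEquiv
  have h := ContinuousLinearMap.ext_on (f := T'.comp Q) (g := Q.comp T')
    (Submodule.dense_iff_topologicalClosure_eq_top.2 b.dense_span) (by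
      rintro _ ⟨y, rfl⟩
      exact hb y)
  exact congr($h v)

/-- Flipping the sign of region $k$ multiplies an entry by $-1$ when exactly one endpoint lies in
$k$. Over the three $k$ these factors sum to $3$ within a region and to $-1$ across, and
$(3-1)/2=1$, $(-1-1)/2=-1$. Boundedness thus comes for free. -/
theorem exists_isTwistOf_blockSign (b : HilbertBasis ι ℂ H) (pos : ι → ℂ) (reg : ℂ → Fin 3)
    (P : H →L[ℂ] H) : ∃ Q : H →L[ℂ] H, IsTwistOf b pos (blockSign reg) P Q := by
  let a : Fin 3 → ι → ℂ := fun k x => if reg (pos x) = k then -1 else 1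
  have ha (k x) : ‖a k x‖ = 1 := by
    simp only [a]
    split_ifs <;> simp
  choose G hG using fun k => b.exists_gauge (a k) (ha k)
  refine ⟨(2 : ℂ)⁻¹ • ((G 0).conjStarAlgEquiv P + (G 1).conjStarAlgEquiv P
    + (G 2).conjStarAlgEquiv P - P), fun x y => ?_⟩
  have h1 : matEntry b ((2 : ℂ)⁻¹ • ((G 0).conjStarAlgEquiv P + (G 1).conjStarAlgEquiv P
      + (G 2).conjStarAlgEquiv P - P)) x y = 2⁻¹ * (matEntry b ((G 0).conjStarAlgEquiv P
      + (G 1).conjStarAlgEquiv P + (G 2).conjStarAlgEquiv P - P) x y) := inner_smul_right _ _ _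
  rw [h1, matEntry_sub, matEntry_add, matEntry_add]
  simp only [matEntry_conj_gauge (ha _) (hG _), a, blockSign]
  generalize reg (pos x) = i
  generalize reg (pos y) = j
  fin_cases i <;> fin_cases j <;> simp <;> ring

end Twist

/-! ### Summability from bounded density, and near-idempotence of the block twist. -/

section Density

variable {ι : Type*} {pos : ι → ℂ}

theorem summable_comp_of_card_fiber_le {α β : Type*} [DecidableEq β] {g : α → β} {M : ℕ}
    (hg : ∀ (s : Finset α) (q : β), (s.filter fun a => g a = q).card ≤ M) {h : β → ℝ}
    (h0 : ∀ q, 0 ≤ h q) (hs : Summable h) : Summable fun a => h (g a) := by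
  refine summable_of_sum_le (fun a => h0 _) (c := M * ∑' q, h q) fun s => ?_
  rw [Finset.sum_comp h g]
  calc ∑ q ∈ s.image g, (s.filter fun a => g a = q).card • h q
      ≤ ∑ q ∈ s.image g, M * h q := by
        refine Finset.sum_le_sum fun q _ => ?_
        rw [nsmul_eq_mul]
        exact mul_le_mul_of_nonneg_right (by exact_mod_cast hg s q) (h0 q)
    _ = M * ∑ q ∈ s.image g, h q := (Finset.mul_sum _ _ _).symm
    _ ≤ M * ∑' q, h q := by
        gcongr
        exact hs.sum_le_tsum _ fun q _ => h0 q

theorem summable_exp_neg_mul_abs_int {c : ℝ} (hc : 0 < c) :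
    Summable fun m : ℤ => Real.exp (-c * |(m : ℝ)|) := by
  have h : Summable fun n : ℕ => Real.exp (-c * n) := by
    have := Real.summable_exp_nat_mul_iff.2 (neg_lt_zero.2 hc)
    exact this.congr fun n => by rw [mul_comm]
  refine Summable.of_nat_of_neg ?_ ?_ <;> simpa using h

/-- For sites of bounded density, exponentials of the distance from a point are summable. -/
theorem HasBoundedDensity.summable_exp (hpos : HasBoundedDensity pos) (O : ℂ) {c : ℝ}
    (hc : 0 < c) : Summable fun x => Real.exp (-c * dist (pos x) O) := by
  obtain ⟨M, hM⟩ := hpos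
  -- Each unit cell lies in the unit disk about its centre, so it holds at most $M$ orbitals. The
  -- halved rate below comes from $|\mathrm{Re}\,z|+|\mathrm{Im}\,z|\le2|z|$; the factor
  -- $e^{c(1+\|O\|)}$ absorbs rounding and the shift to $O$.
  let g : ι → ℤ × ℤ := fun x => (⌊(pos x).re⌋, ⌊(pos x).im⌋)
  have hg (s : Finset ι) (q : ℤ × ℤ) : (s.filter fun x => g x = q).card ≤ M := by
    have h1 : ((s.filter fun x => g x = q : Finset ι) : Set ι) ⊆
        {x | dist (pos x) ⟨q.1 + 1 / 2, q.2 + 1 / 2⟩ ≤ 1} := by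
      intro x hx
      obtain ⟨-, rfl⟩ := Finset.mem_filter.1 hx
      have h2 := Int.floor_le (pos x).re
      have h3 := Int.lt_floor_add_one (pos x).re
      have h4 := Int.floor_le (pos x).im
      have h5 := Int.lt_floor_add_one (pos x).im
      rw [Set.mem_ofPred_eq, Complex.dist_eq_re_im]
      refine Real.sqrt_le_one.2 ?_
      simp only [g]
      nlinarith
    have h2 := (Set.encard_le_encard h1).trans (hM _)
    rw [Set.encard_coe_eq_coe_finsetCard] at h2
    exact_mod_cast h2
  let h : ℤ × ℤ → ℝ := fun q =>
    Real.exp (c * (1 + ‖O‖)) * (Real.exp (-(c / 2) * |(q.1 : ℝ)|) * Real.exp (-(c / 2) * |(q.2 : ℝ)|))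
  have hs : Summable h := by
    refine Summable.mul_left _ ?_
    have h1 := summable_exp_neg_mul_abs_int (half_pos hc)
    exact h1.mul_of_nonneg h1 (fun _ => (Real.exp_pos _).le) fun _ => (Real.exp_pos _).le
  refine Summable.of_nonneg_of_le (fun x => (Real.exp_pos _).le) (fun x => ?_)
    (summable_comp_of_card_fiber_le hg (fun q => by positivity) hs)
  simp only [h, ← Real.exp_add]
  refine Real.exp_le_exp.2 ?_
  have h1 : |(pos x).re| ≤ ‖pos x‖ := Complex.abs_re_le_norm _
  have h2 : |(pos x).im| ≤ ‖pos x‖ := Complex.abs_im_le_norm _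
  have h3 : ‖pos x‖ ≤ dist (pos x) O + ‖O‖ := by
    rw [dist_eq_norm]
    simpa using norm_add_le (pos x - O) O
  have h4 (t : ℝ) : |(⌊t⌋ : ℝ)| ≤ |t| + 1 := by
    have h5 := Int.floor_le t
    have h6 := Int.lt_floor_add_one t
    rw [abs_le]
    constructor <;> cases abs_cases t <;> linarith
  have h5 := h4 (pos x).re
  have h6 := h4 (pos x).im
  simp only [g]
  nlinarith

theorem HasBoundedDensity.summable_exp_pair (hpos : HasBoundedDensity pos) (O : ℂ) {c : ℝ}
    (hc : 0 < c) : Summable fun p : ι × ι =>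
      Real.exp (-c * (dist (pos p.1) O + dist (pos p.2) O)) := by
  have h1 := hpos.summable_exp O hc
  refine (h1.mul_of_nonneg h1 (fun _ => (Real.exp_pos _).le)
    fun _ => (Real.exp_pos _).le).congr fun p => ?_
  rw [← Real.exp_add]
  ring_nf

/-- Entries that decay exponentially and vanish unless the distance is comparable to the distance
from `O` are absolutely summable. -/
theorem HasBoundedDensity.summable_of_near (hpos : HasBoundedDensity pos) (O : ℂ)
    {m : ι → ι → ℂ} {C c A B : ℝ} (hC : 0 ≤ C) (hc : 0 < c) (hA : 0 < A)
    (hm : ∀ x y, ‖m x y‖ ≤ C * Real.exp (-c * dist (pos x) (pos y)))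
    (hnear : ∀ x y, m x y ≠ 0 →
      dist (pos x) O + dist (pos y) O ≤ A * dist (pos x) (pos y) + B) :
    Summable fun p : ι × ι => ‖m p.1 p.2‖ := by
  refine Summable.of_nonneg_of_le (fun _ => norm_nonneg _) (fun p => ?_)
    ((hpos.summable_exp_pair O (div_pos hc hA)).mul_left (C * Real.exp (c / A * B)))
  by_cases h : m p.1 p.2 = 0
  · rw [h, norm_zero]
    positivity
  · refine (hm _ _).trans ?_
    rw [mul_assoc, ← Real.exp_add]
    gcongr
    have h1 := mul_le_mul_of_nonneg_left (hnear _ _ h) (div_pos hc hA).le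
    have h2 : c / A * (A * dist (pos p.1) (pos p.2) + B) =
        c * dist (pos p.1) (pos p.2) + c / A * B := by
      field_simp
    linarith

variable {H : Type*} [NormedAddCommGroup H] [InnerProductSpace ℂ H] [CompleteSpace H]

/-- The cocycle relation fails only for three distinct regions, where it would read $-1=(-1)(-1)$.
-/
theorem blockSign_mul_ne {reg : ℂ → Fin 3} {u v w : ℂ}
    (h : blockSign reg u w ≠ blockSign reg u v * blockSign reg v w) :
    reg u ≠ reg v ∧ reg v ≠ reg w ∧ reg w ≠ reg u := by
  unfold blockSign at h
  refine ⟨fun h1 => h ?_, fun h1 => h ?_, fun h1 => h ?_⟩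
  · simp [h1]
  · simp [h1]
  · simp only [h1, eq_comm]
    split_ifs <;> simp

theorem norm_blockSign (reg : ℂ → Fin 3) (z w : ℂ) : ‖blockSign reg z w‖ = 1 := by
  unfold blockSign
  split_ifs <;> simp

theorem IsGoodPartition.spread_of_ne {O : ℂ} {reg : ℂ → Fin 3} (hreg : IsGoodPartition O reg) :
    ∃ c K : ℝ, 0 < c ∧ ∀ u v w : ℂ, reg u ≠ reg v → reg v ≠ reg w → reg w ≠ reg u →
      c * (dist u O + dist v O + dist w O) ≤ dist u v + dist v w + dist w u + K := by
  obtain ⟨c, K, hc, h⟩ := hreg.spread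
  refine ⟨c, K, hc, fun u v w h1 h2 h3 => ?_⟩
  have hcases : ∀ i j k : Fin 3, i ≠ j → j ≠ k → k ≠ i →
      (i = 0 ∧ j = 1 ∧ k = 2) ∨ (i = 0 ∧ j = 2 ∧ k = 1) ∨ (i = 1 ∧ j = 0 ∧ k = 2) ∨
      (i = 1 ∧ j = 2 ∧ k = 0) ∨ (i = 2 ∧ j = 0 ∧ k = 1) ∨ (i = 2 ∧ j = 1 ∧ k = 0) := by
    intro i j k
    fin_cases i <;> fin_cases j <;> fin_cases k <;> simp
  have e1 := dist_comm u v
  have e2 := dist_comm v w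
  have e3 := dist_comm w u
  rcases hcases _ _ _ h1 h2 h3 with ⟨a, b, d⟩ | ⟨a, b, d⟩ | ⟨a, b, d⟩ | ⟨a, b, d⟩ | ⟨a, b, d⟩ |
    ⟨a, b, d⟩
  · linarith [h u v w a b d]
  · linarith [h u w v a d b]
  · linarith [h v u w b a d]
  · linarith [h w u v d a b]
  · linarith [h v w u b d a]
  · linarith [h w v u d b a]

/-- The topologically twisted projection is a projection up to a nuclear operator. -/
theorem IsTwistOf.isNuclear_sub_sq.{w, w'} {ι : Type w} {H : Type w'} [NormedAddCommGroup H]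
    [InnerProductSpace ℂ H] [CompleteSpace H] {b : HilbertBasis ι ℂ H} {pos : ι → ℂ}
    (hpos : HasBoundedDensity pos) {P Q : H →L[ℂ] H} (hP : IsStarProjection P)
    (hdecay : HasExpDecay b pos P) {O : ℂ} {reg : ℂ → Fin 3} (hreg : IsGoodPartition O reg)
    (hQ : IsTwistOf b pos (blockSign reg) P Q) : IsNuclear.{w} (Q - Q * Q) := by
  obtain ⟨C, a, hC, ha, hdec⟩ := hdecay
  obtain ⟨c, K, hc, hspread⟩ := hreg.spread_of_ne
  let σ : ι → ι → ℂ := fun x y => blockSign reg (pos x) (pos y)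
  have hσ (x y) : ‖σ x y‖ = 1 := norm_blockSign _ _ _
  let F : (ι × ι) × ι → ℂ := fun p =>
    (σ p.1.1 p.1.2 - σ p.1.1 p.2 * σ p.2 p.1.2) * (matEntry b P p.1.1 p.2 * matEntry b P p.2 p.1.2)
  have hF : Summable fun p => ‖F p‖ := by
    -- The triangle inequality bounds the perimeter of $x,y,z$ by twice the path $x,z,y$. The spread
    -- condition therefore costs a factor $1/2$, giving the rate $ac/2$ and the constant $e^{aK/2}$.
    have hκ : 0 < a * c / 2 := by positivity
    refine Summable.of_nonneg_of_le (fun _ => norm_nonneg _) (fun p => ?_)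
      (((hpos.summable_exp_pair O hκ).mul_of_nonneg (hpos.summable_exp O hκ)
        (fun _ => (Real.exp_pos _).le) fun _ => (Real.exp_pos _).le).mul_left
        (2 * C * C * Real.exp (a * K / 2)))
    obtain ⟨⟨x, y⟩, z⟩ := p
    by_cases h : σ x y = σ x z * σ z y
    · simp only [F, h, sub_self, zero_mul, norm_zero]
      positivity
    · obtain ⟨h1, h2, h3⟩ := blockSign_mul_ne h
      have h4 := hspread _ _ _ h1 h2 h3
      have h5 := dist_triangle (pos x) (pos z) (pos y)
      rw [dist_comm (pos y) (pos x)] at h4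
      have h6 : ‖σ x y - σ x z * σ z y‖ ≤ 2 := by
        refine (norm_sub_le _ _).trans ?_
        rw [norm_mul, hσ, hσ, hσ]
        norm_num
      calc ‖F ((x, y), z)‖ ≤ 2 * ((C * Real.exp (-a * dist (pos x) (pos z))) *
            (C * Real.exp (-a * dist (pos z) (pos y)))) := by
            simp only [F, norm_mul]
            gcongr
            · exact hdec x z
            · exact hdec z y
        _ = 2 * C * C * Real.exp (-a * dist (pos x) (pos z) + -a * dist (pos z) (pos y)) := by
            rw [Real.exp_add]
            ring
        _ ≤ 2 * C * C * Real.exp (a * K / 2 + (-(a * c / 2) * (dist (pos x) O + dist (pos y) O)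
            + -(a * c / 2) * dist (pos z) O)) := by
            refine mul_le_mul_of_nonneg_left (Real.exp_le_exp.2 ?_) (by positivity)
            nlinarith
        _ = _ := by
            rw [Real.exp_add, Real.exp_add]
            ring
  refine isNuclear_of_summable_matEntry b ?_
  refine Summable.of_nonneg_of_le (fun _ => norm_nonneg _) (fun p => ?_) hF.prod
  have h1 : HasSum (fun z => F (p, z)) (matEntry b (Q - Q * Q) p.1 p.2) := by
    have h2 := (hasSum_matEntry_mul b P P p.1 p.2).mul_left (σ p.1 p.2)
    rw [hP.isIdempotentElem.eq, ← hQ] at h2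
    rw [matEntry_sub]
    convert! h2.sub (hasSum_matEntry_mul b Q Q p.1 p.2) using 1
    ext z
    simp only [F, hQ _ _, σ]
    ring
  rw [← h1.tsum_eq]
  exact norm_tsum_le_tsum_norm (hF.prod_factor p)

end Density

/-! ### Square roots in the plane and their monodromy. -/

section Topology

open Complex

/-- Lifting through the covering $\exp:\mathbb C\to\mathbb C\setminus\{0\}$. -/
theorem exists_continuous_exp_lift {X : Type*} [TopologicalSpace X] [SimplyConnectedSpace X]
    [LocallyPathConnectedSpace X] {f : X → ℂ} (hf : Continuous f) (h0 : ∀ x, f x ≠ 0) :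
    ∃ L : X → ℂ, Continuous L ∧ ∀ x, exp (L x) = f x := by
  obtain ⟨x₀⟩ := (inferInstance : Nonempty X)
  obtain ⟨L, ⟨-, hL⟩, -⟩ := isCoveringMapOn_exp.existsUnique_continuousMap_lifts ⟨f, hf⟩
    (exp_log (h0 x₀)) (fun x => h0 x)
  exact ⟨L, L.continuous, fun x => congrFun hL x⟩

/-- For a homeomorphism `h` of the plane, the continuous square root of `h⁻¹(O + e^ζ)`
is antiperiodic. -/
theorem Homeomorph.exists_antiperiodic_sqrt (h : ℂ ≃ₜ ℂ) {O : ℂ} (hO : h 0 = O) :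
    ∃ K : ℂ → ℂ, Continuous K ∧ (∀ ζ, K ζ ^ 2 = h.symm (O + exp ζ)) ∧
      ∀ ζ, K (ζ + 2 * Real.pi * I) = -K ζ := by
  have hne (z : ℂ) (hz : z ≠ O) : h.symm z ≠ 0 := by
    intro h0
    exact hz (by rw [← hO, ← h0, h.apply_symm_apply])
  obtain ⟨L, hL, hexp⟩ := exists_continuous_exp_lift (f := fun ζ : ℂ => h.symm (O + exp ζ))
    (by fun_prop) (fun ζ => hne _ (by simp [exp_ne_zero]))
  have hK : Continuous fun ζ => exp (L ζ / 2) := by fun_prop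
  have hsq (ζ : ℂ) : exp (L ζ / 2) ^ 2 = h.symm (O + exp ζ) := by
    rw [← exp_nat_mul, ← hexp]
    congr 1
    push_cast
    ring
  refine ⟨fun ζ => exp (L ζ / 2), hK, hsq, ?_⟩
  have hper (ζ : ℂ) : exp (ζ + 2 * Real.pi * I) = exp ζ := exp_periodic ζ
  rcases isPreconnected_univ.eq_or_eq_neg_of_sq_eq
    (f := fun ζ => exp (L (ζ + 2 * Real.pi * I) / 2)) (g := fun ζ => exp (L ζ / 2))
    (by fun_prop) hK.continuousOn (fun ζ _ => by
      change exp (L (ζ + 2 * Real.pi * I) / 2) ^ 2 = exp (L ζ / 2) ^ 2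
      rw [hsq, hsq, hper]) (fun _ => exp_ne_zero _) with heq | heq
  · exfalso
    -- If $K$ were periodic, it would give a single-valued square root of $h^{-1}$ off $O$. Along
    -- the $h$-image of the unit circle this root is $\pm e^{it/2}$, which does not return to its
    -- initial value.
    obtain ⟨l, hl, hlexp⟩ := exists_continuous_exp_lift
      (f := fun t : ℝ => h (exp (t * I)) - O) (by fun_prop) (fun t h0 => by
        rw [sub_eq_zero, ← hO] at h0
        exact exp_ne_zero _ (h.injective h0))
    have hk2 (t : ℝ) : exp (L (l t) / 2) ^ 2 = exp (t * I / 2) ^ 2 := by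
      rw [hsq, hlexp, add_sub_cancel, h.symm_apply_apply, ← exp_nat_mul]
      congr 1
      push_cast
      ring
    have hint (ζ : ℂ) (n : ℤ) : exp (L (ζ + n * (2 * Real.pi * I)) / 2) = exp (L ζ / 2) :=
      Function.Periodic.int_mul (f := fun ζ => exp (L ζ / 2)) (fun ζ => heq (Set.mem_univ ζ)) n ζ
    obtain ⟨n, hn⟩ : ∃ n : ℤ, l (2 * Real.pi) = l 0 + n * (2 * Real.pi * I) := by
      rw [← exp_eq_exp_iff_exists_int, hlexp, hlexp]
      simp [exp_two_pi_mul_I]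
    have hend : exp (L (l (2 * Real.pi)) / 2) = exp (L (l 0) / 2) := by rw [hn, hint]
    have e0 : exp (((2 * Real.pi : ℝ) : ℂ) * I / 2) = -1 := by
      rw [← exp_pi_mul_I]
      congr 1
      push_cast
      ring
    have hne' := exp_ne_zero (L (l 0) / 2)
    rcases isPreconnected_univ.eq_or_eq_neg_of_sq_eq
      (f := fun t : ℝ => exp (L (l t) / 2)) (g := fun t : ℝ => exp (t * I / 2))
      (by fun_prop) (by fun_prop) (fun t _ => hk2 t) (fun _ => exp_ne_zero _) with h1 | h1
    · have a := h1 (Set.mem_univ 0)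
      have b := h1 (Set.mem_univ (2 * Real.pi))
      simp only [e0, hend] at a b
      rw [b] at a
      norm_num at a
    · have a := h1 (Set.mem_univ 0)
      have b := h1 (Set.mem_univ (2 * Real.pi))
      simp only [Pi.neg_apply, e0, hend] at a b
      rw [b] at a
      norm_num at a
  · intro ζ
    exact heq (Set.mem_univ ζ)

/-- The sign `±1` by which the principal branch of `√(· - O)` at `w` differs from its continuation
along the segment from `z` to `w`. -/
def fluxSign (O z w : ℂ) : ℂ := exp ((log (w - O) - log (z - O) - log ((w - O) / (z - O))) / 2)

theorem exists_fluxSign_eq {O z w : ℂ} (hz : z ≠ O) (hw : w ≠ O) :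
    ∃ n : ℤ, log (z - O) + log ((w - O) / (z - O)) = log (w - O) + n * (2 * Real.pi * I) ∧
      fluxSign O z w = exp (n * (Real.pi * I)) := by
  have hz' := sub_ne_zero.2 hz
  have hw' := sub_ne_zero.2 hw
  obtain ⟨n, hn⟩ : ∃ n : ℤ, log (z - O) + log ((w - O) / (z - O)) =
      log (w - O) + n * (2 * Real.pi * I) := by
    rw [← exp_eq_exp_iff_exists_int, exp_add, exp_log hz', exp_log hw',
      exp_log (div_ne_zero hw' hz'), mul_div_cancel₀ _ hz']
  refine ⟨n, hn, ?_⟩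
  rw [fluxSign, exp_eq_exp_iff_exists_int]
  refine ⟨-n, ?_⟩
  push_cast
  linear_combination -hn / 2

theorem exp_int_mul_pi_mul_I_of_even {n : ℤ} (hn : Even n) : exp (n * (Real.pi * I)) = 1 := by
  rw [exp_int_mul, exp_pi_mul_I, hn.neg_one_zpow]

theorem exp_int_mul_pi_mul_I_of_odd {n : ℤ} (hn : Odd n) : exp (n * (Real.pi * I)) = -1 := by
  rw [exp_int_mul, exp_pi_mul_I, hn.neg_one_zpow]

theorem exp_int_mul_pi_mul_I_eq (n : ℤ) :
    exp (n * (Real.pi * I)) = 1 ∨ exp (n * (Real.pi * I)) = -1 := by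
  rcases n.even_or_odd with h | h
  · exact Or.inl (exp_int_mul_pi_mul_I_of_even h)
  · exact Or.inr (exp_int_mul_pi_mul_I_of_odd h)

theorem fluxSign_eq_one_or {O z w : ℂ} (hz : z ≠ O) (hw : w ≠ O) :
    fluxSign O z w = 1 ∨ fluxSign O z w = -1 := by
  obtain ⟨n, -, h⟩ := exists_fluxSign_eq hz hw
  rw [h]
  exact exp_int_mul_pi_mul_I_eq n

theorem antiperiodic_add_int_mul {K : ℂ → ℂ} (hK : ∀ ζ, K (ζ + 2 * Real.pi * I) = -K ζ) (ζ : ℂ)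
    (n : ℤ) : K (ζ + n * (2 * Real.pi * I)) = exp (n * (Real.pi * I)) * K ζ := by
  have hnat (ζ : ℂ) (n : ℕ) : K (ζ + n * (2 * Real.pi * I)) = (-1) ^ n * K ζ := by
    induction n with
    | zero => simp
    | succ n ih =>
      rw [pow_succ, mul_neg_one, neg_mul, ← ih, ← hK]
      congr 1
      push_cast
      ring
  obtain ⟨m, rfl | rfl⟩ := n.eq_nat_or_neg
  · rw [exp_int_mul, exp_pi_mul_I]
    simpa using hnat ζ m
  · have h := hnat (ζ + ((-m : ℤ) : ℂ) * (2 * Real.pi * I)) m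
    rw [show ζ + ((-m : ℤ) : ℂ) * (2 * Real.pi * I) + m * (2 * Real.pi * I) = ζ by
      push_cast; ring] at h
    rw [exp_int_mul, exp_pi_mul_I, h, ← mul_assoc]
    simp

/-- The square root on the complement of a sector, compared with polar coordinates. -/
theorem sqrt_off_sector {ρ θ : ℝ} (hρ : 0 < ρ) {j r : ℕ} {m : ℤ}
    (hθ₁ : 2 * Real.pi * r / 3 ≤ θ) (hθ₂ : θ ≤ 2 * Real.pi * (r + 1) / 3)
    (hm : (r : ℤ) - j - 2 + 3 * m = -1 ∨ (r : ℤ) - j - 2 + 3 * m = 0) :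
    ρ * exp (θ * I) * exp (-((2 * Real.pi * j / 3 + 4 * Real.pi / 3 : ℝ) * I)) ∈ slitPlane ∧
    exp (log (ρ * exp (θ * I) * exp (-((2 * Real.pi * j / 3 + 4 * Real.pi / 3 : ℝ) * I))) / 2) =
      exp (((Real.log ρ : ℝ) + θ * I) / 2) *
        exp (-((Real.pi * j / 3 + 2 * Real.pi / 3 : ℝ) * I)) * exp (m * (Real.pi * I)) := by
  have hπ := Real.pi_pos
  -- The angle $2\pi j/3+4\pi/3$ bisects the complement of sector $j$; rotating it to zero puts that
  -- complement within $|\varphi|\le2\pi/3$. The integer $m$ brings $\varphi$ to the principal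
  -- branch and shows up as the half-turn factor $e^{im\pi}$.
  set φ : ℝ := θ - (2 * Real.pi * j / 3 + 4 * Real.pi / 3) + 2 * Real.pi * m with hφ
  have hm1 : (-1 : ℝ) ≤ (r : ℝ) - j - 2 + 3 * m ∧ (r : ℝ) - j - 2 + 3 * m ≤ 0 := by
    rcases hm with h | h
    · have : (r : ℝ) - j - 2 + 3 * m = -1 := by exact_mod_cast h
      constructor <;> linarith
    · have : (r : ℝ) - j - 2 + 3 * m = 0 := by exact_mod_cast h
      constructor <;> linarith
  have hφ1 : -Real.pi < φ := by
    have := mul_le_mul_of_nonneg_left hm1.1 hπ.le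
    linarith
  have hφ2 : φ < Real.pi := by
    have := mul_le_mul_of_nonneg_left hm1.2 hπ.le
    linarith
  have hw : ρ * exp (θ * I) * exp (-((2 * Real.pi * j / 3 + 4 * Real.pi / 3 : ℝ) * I)) =
      exp ((Real.log ρ : ℝ) + φ * I) := by
    have h1 : (ρ : ℂ) = exp (Real.log ρ : ℝ) := by
      rw [← ofReal_exp, Real.exp_log hρ]
    rw [h1, ← exp_add, ← exp_add, exp_eq_exp_iff_exists_int]
    refine ⟨-m, ?_⟩
    rw [hφ]
    push_cast
    ring
  have hlog : log (exp ((Real.log ρ : ℝ) + φ * I)) = (Real.log ρ : ℝ) + φ * I :=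
    log_exp (by simpa using hφ1) (by simpa using hφ2.le)
  rw [hw, hlog]
  constructor
  · rw [mem_slitPlane_iff_arg]
    refine ⟨?_, exp_ne_zero _⟩
    rw [← log_im, hlog]
    simpa using hφ2.ne
  · rw [← exp_add, ← exp_add, hφ]
    congr 1
    push_cast
    ring

end Topology

/-! ### Block signs as monodromy of a square root. -/

section Regions

open Complex

/-- Square roots along a connected set that misses a region: the phase relative to polar
coordinates jumps exactly between the two other regions. -/
theorem sqrt_ratio_eq_blockSign {U : Set ℂ} (hU : IsPreconnected U) {reg : ℂ → Fin 3}
    {f q : ℂ → ℂ} {ρ θ : ℂ → ℝ} (hf : ContinuousOn f U) (hq : ContinuousOn q U)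
    (hqf : ∀ z ∈ U, q z ^ 2 = f z) (hρ : ∀ z ∈ U, 0 < ρ z)
    (hθ₁ : ∀ z, 2 * Real.pi * (reg z : ℕ) / 3 ≤ θ z)
    (hθ₂ : ∀ z, θ z ≤ 2 * Real.pi * ((reg z : ℕ) + 1) / 3)
    (hpolar : ∀ z, f z = ρ z * exp (θ z * I)) (j : Fin 3) (hj : ∀ z ∈ U, reg z ≠ j)
    {z w : ℂ} (hz : z ∈ U) (hw : w ∈ U) :
    q z * exp (((Real.log (ρ w) : ℝ) + θ w * I) / 2 + (reg w : ℕ) * (Real.pi * I)) =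
      blockSign reg z w * (q w *
        exp (((Real.log (ρ z) : ℝ) + θ z * I) / 2 + (reg z : ℕ) * (Real.pi * I))) := by
  have hm (u : ℂ) (hu : u ∈ U) : ∃ m : ℤ, ((reg u : ℕ) : ℤ) - (j : ℕ) - 2 + 3 * m = -1 ∨
      ((reg u : ℕ) : ℤ) - (j : ℕ) - 2 + 3 * m = 0 := by
    have h1 : (reg u : ℕ) ≠ j := fun h => hj u hu (Fin.ext h)
    have h2 := (reg u).2
    have h3 := j.2
    exact ⟨-((((reg u : ℕ) : ℤ) - (j : ℕ) - 1) / 3), by omega⟩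
  set E := exp (-((2 * Real.pi * (j : ℕ) / 3 + 4 * Real.pi / 3 : ℝ) * I)) with hE
  set κ := exp (-((Real.pi * (j : ℕ) / 3 + 2 * Real.pi / 3 : ℝ) * I))
  have hsec (u : ℂ) (hu : u ∈ U) (m : ℤ) (h : ((reg u : ℕ) : ℤ) - (j : ℕ) - 2 + 3 * m = -1 ∨
      ((reg u : ℕ) : ℤ) - (j : ℕ) - 2 + 3 * m = 0) : f u * E ∈ slitPlane ∧
      exp (log (f u * E) / 2) =
        exp (((Real.log (ρ u) : ℝ) + θ u * I) / 2) * κ * exp (m * (Real.pi * I)) := by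
    rw [hpolar]
    exact sqrt_off_sector (hρ u hu) (hθ₁ u) (hθ₂ u) h
  have hc : ContinuousOn (fun u => exp (log (f u * E) / 2)) U := by
    refine ContinuousOn.cexp (ContinuousOn.div_const (ContinuousOn.clog (by fun_prop) ?_) 2)
    intro u hu
    obtain ⟨m, h⟩ := hm u hu
    exact (hsec u hu m h).1
  have hE0 : E ≠ 0 := exp_ne_zero _
  set e := exp (-((2 * Real.pi * (j : ℕ) / 3 + 4 * Real.pi / 3 : ℝ) * I) / 2) with he
  have heE : e ^ 2 = E := by
    rw [he, hE, ← exp_nat_mul]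
    congr 1
    push_cast
    ring
  -- On the connected set $U$, two continuous nonvanishing square roots of $f\cdot E$ differ by one
  -- global sign, absorbed in $c$.
  have hsign : ∃ c : ℂ, c ≠ 0 ∧ ∀ u ∈ U, q u * c = exp (log (f u * E) / 2) := by
    rcases hU.eq_or_eq_neg_of_sq_eq (f := fun u => exp (log (f u * E) / 2))
      (g := fun u => q u * e) hc (by fun_prop) (fun u hu => by
        obtain ⟨m, h⟩ := hm u hu
        change exp (log (f u * E) / 2) ^ 2 = (q u * e) ^ 2
        rw [← exp_nat_mul, mul_pow, hqf u hu, heE]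
        push_cast
        rw [mul_div_cancel₀ _ two_ne_zero, exp_log (slitPlane_ne_zero (hsec u hu m h).1)])
      (fun {u} hu => by
        refine mul_ne_zero (fun h0 => ?_) (exp_ne_zero _)
        have h1 := hqf u hu
        rw [h0, hpolar] at h1
        simp [(hρ u hu).ne', exp_ne_zero] at h1) with h | h
    · exact ⟨e, exp_ne_zero _, fun u hu => (h hu).symm⟩
    · exact ⟨-e, neg_ne_zero.2 (exp_ne_zero _), fun u hu => by
        rw [mul_neg]
        exact (h hu).symm⟩
  obtain ⟨c, hc0, hcq⟩ := hsign
  obtain ⟨m, hmz⟩ := hm z hz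
  obtain ⟨n, hnw⟩ := hm w hw
  have hz1 := (hcq z hz).trans (hsec z hz m hmz).2
  have hw1 := (hcq w hw).trans (hsec w hw n hnw).2
  have hcast (i : Fin 3) : exp ((i : ℕ) * (Real.pi * I)) = exp (((i : ℕ) : ℤ) * (Real.pi * I)) := by
    push_cast
    rfl
  -- For two distinct regions other than $j$, the congruences defining $m$ and $n$ make
  -- $m+\mathrm{reg}\,w$ and $n+\mathrm{reg}\,z$ of opposite parity; for equal regions $m=n$.
  have hsgn : exp (m * (Real.pi * I)) * exp ((reg w : ℕ) * (Real.pi * I)) =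
      blockSign reg z w * (exp (n * (Real.pi * I)) * exp ((reg z : ℕ) * (Real.pi * I))) := by
    rw [hcast, hcast]
    have h1 (k l : ℤ) : exp (k * (Real.pi * I)) * exp (l * (Real.pi * I)) =
        exp ((k + l : ℤ) * (Real.pi * I)) := by
      rw [← exp_add]
      push_cast
      ring_nf
    rw [h1, h1]
    unfold blockSign
    split_ifs with h
    · have h2 : m = n := by
        rw [h] at hmz
        omega
      rw [h, h2, one_mul]
    · have h3 : (reg z : ℕ) ≠ reg w := fun h' => h (Fin.ext h')
      have h4 := (reg z).2
      have h5 := (reg w).2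
      have h6 := j.2
      rcases (n + ((reg z : ℕ) : ℤ)).even_or_odd with h2 | h2
      · rw [exp_int_mul_pi_mul_I_of_even h2, exp_int_mul_pi_mul_I_of_odd, mul_one]
        rw [Int.odd_iff]
        rw [Int.even_iff] at h2
        omega
      · rw [exp_int_mul_pi_mul_I_of_odd h2, exp_int_mul_pi_mul_I_of_even, neg_one_mul, neg_neg]
        rw [Int.even_iff]
        rw [Int.odd_iff] at h2
        omega
  rw [exp_add, exp_add]
  refine mul_right_cancel₀ hc0 ?_
  generalize exp (((Real.log (ρ w) : ℝ) + θ w * I) / 2) = η at *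
  generalize exp (((Real.log (ρ z) : ℝ) + θ z * I) / 2) = ξ at *
  calc q z * (η * exp ((reg w : ℕ) * (Real.pi * I))) * c
      = q z * c * (η * exp ((reg w : ℕ) * (Real.pi * I))) := by ring
    _ = ξ * κ * η * (exp (m * (Real.pi * I)) * exp ((reg w : ℕ) * (Real.pi * I))) := by
        rw [hz1]; ring
    _ = blockSign reg z w * ((q w * c) * (ξ * exp ((reg z : ℕ) * (Real.pi * I)))) := by
        rw [hsgn, hw1]; ring
    _ = _ := by ring

/-- The quotient is within distance less than $1$ of $1$, hence in the right half plane. -/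
theorem div_mem_slitPlane_of_dist_lt {O z w : ℂ} (h : dist w z < dist z O) :
    (w - O) / (z - O) ∈ slitPlane := by
  have hz : z ≠ O := by
    rintro rfl
    rw [dist_self] at h
    exact h.not_ge dist_nonneg
  have hz' := sub_ne_zero.2 hz
  rw [dist_eq_norm, dist_eq_norm] at h
  have h1 : ‖(w - O) / (z - O) - 1‖ < 1 := by
    rw [div_sub_one hz', sub_sub_sub_cancel_right, norm_div, div_lt_one (norm_pos_iff.2 hz')]
    exact h
  refine Or.inl ?_
  have h2 := (abs_re_le_norm _).trans_lt h1
  rw [sub_re, one_re] at h2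
  linarith [(abs_lt.1 h2).1]

/-- Away from the vertex, and for pairs of points that are close on the scale of the distance from
the vertex, the sign pattern of a good partition is gauge equivalent to the half flux signs. -/
theorem IsGoodPartition.exists_gauge_fluxSign {O : ℂ} {reg : ℂ → Fin 3}
    (hreg : IsGoodPartition O reg) :
    ∃ (v : ℂ → ℂ) (ε R : ℝ), 0 < ε ∧ ε < 1 ∧ 0 < R ∧ (∀ z, v z = 1 ∨ v z = -1) ∧
      ∀ z w, R ≤ dist z O → dist w z ≤ ε * dist z O →
        fluxSign O z w = v z * v w * blockSign reg z w := by
  obtain ⟨h, hO, hsec⟩ := hreg.sectors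
  obtain ⟨c, K₀, hc, hspread⟩ := hreg.spread
  obtain ⟨K, hK, hK2, hKanti⟩ := h.exists_antiperiodic_sqrt hO
  have hpol (z : ℂ) : ∃ ρ θ : ℝ, 0 ≤ ρ ∧ 2 * Real.pi * (reg z : ℕ) / 3 ≤ θ ∧
      θ ≤ 2 * Real.pi * ((reg z : ℕ) + 1) / 3 ∧ h.symm z = ρ * exp (θ * I) := by
    obtain ⟨w, ⟨ρ, θ, h1, h2, h3, rfl⟩, hw⟩ := hsec z
    exact ⟨ρ, θ, h1, h2, h3, by rw [← hw, h.symm_apply_apply]⟩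
  choose ρ θ hρ0 hθ₁ hθ₂ hpolar using hpol
  have hρ (z : ℂ) (hz : z ≠ O) : 0 < ρ z := by
    refine (hρ0 z).lt_of_ne fun h0 => hz ?_
    have h1 := hpolar z
    rw [← h0, ofReal_zero, zero_mul, h.symm_apply_eq, hO] at h1
    exact h1
  -- The polar square root changes sign only between regions $2$ and $0$. The factor
  -- $(-1)^{\mathrm{reg}}$ makes it change sign across all three boundaries, as the block signs do.
  let η : ℂ → ℂ := fun z =>
    exp (((Real.log (ρ z) : ℝ) + θ z * I) / 2 + (reg z : ℕ) * (Real.pi * I))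
  have hη0 (z) : η z ≠ 0 := exp_ne_zero _
  have hη2 (z : ℂ) (hz : z ≠ O) : η z ^ 2 = h.symm z := by
    have h1 : (ρ z : ℂ) = exp (Real.log (ρ z) : ℝ) := by
      rw [← ofReal_exp, Real.exp_log (hρ z hz)]
    rw [hpolar, h1, ← exp_nat_mul, ← exp_add, exp_eq_exp_iff_exists_int]
    refine ⟨(reg z : ℕ), ?_⟩
    push_cast
    ring
  let v : ℂ → ℂ := fun z => if z = O then 1 else K (log (z - O)) / η z
  have hv (z : ℂ) : v z = 1 ∨ v z = -1 := by
    by_cases hz : z = O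
    · simp [v, hz]
    · refine sq_eq_one_iff.1 ?_
      simp only [v, if_neg hz]
      rw [div_pow, hK2, exp_log (sub_ne_zero.2 hz), add_sub_cancel, ← hη2 z hz,
        div_self (pow_ne_zero 2 (hη0 z))]
  have hε : 0 < min (1 / 2) (c / 8) := lt_min (by norm_num) (by positivity)
  -- Let $d=|z-O|$. If the disk of radius $\varepsilon d$ about $z$ met all three regions, the
  -- spread condition would give $\tfrac32cd\le\tfrac34cd+K_0$, while $R$ forces $K_0\le\tfrac12cd$
  -- and $d\ge1$.
  refine ⟨v, min (1 / 2) (c / 8), max 1 (2 * K₀ / c), hε,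
    (min_le_left _ _).trans_lt (by norm_num), lt_max_of_lt_left one_pos, hv, ?_⟩
  intro z w hzR hzw
  have hd1 : 1 ≤ dist z O := (le_max_left _ _).trans hzR
  have hdK : 2 * K₀ ≤ c * dist z O := by
    have := (le_max_right _ _).trans hzR
    rw [div_le_iff₀ hc] at this
    linarith
  have hε1 := min_le_left (1 / 2) (c / 8)
  have hε2 := min_le_right (1 / 2) (c / 8)
  generalize min (1 / 2) (c / 8) = ε at *
  let U := Metric.closedBall z (ε * dist z O)
  have hUlt (u : ℂ) (hu : u ∈ U) : dist u z < dist z O := by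
    refine lt_of_le_of_lt hu ?_
    nlinarith
  have hUO (u : ℂ) (hu : u ∈ U) : u ≠ O := by
    rintro rfl
    have := hUlt u hu
    rw [dist_comm] at this
    exact this.false
  have hzU : z ∈ U := Metric.mem_closedBall_self (by positivity)
  have hmiss : ∃ j, ∀ u ∈ U, reg u ≠ j := by
    by_contra! hcon
    obtain ⟨u₀, hu₀, h₀⟩ := hcon 0
    obtain ⟨u₁, hu₁, h₁⟩ := hcon 1
    obtain ⟨u₂, hu₂, h₂⟩ := hcon 2
    have hsp := hspread u₀ u₁ u₂ h₀ h₁ h₂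
    have hlow (u : ℂ) (hu : u ∈ U) : dist z O / 2 ≤ dist u O := by
      have h3 := dist_triangle z u O
      have h4 : dist u z ≤ ε * dist z O := hu
      rw [dist_comm z u] at h3
      nlinarith
    have hup (u u' : ℂ) (hu : u ∈ U) (hu' : u' ∈ U) : dist u u' ≤ c / 4 * dist z O := by
      have h3 := dist_triangle_right u u' z
      have h4 : dist u z ≤ ε * dist z O := hu
      have h5 : dist u' z ≤ ε * dist z O := hu'
      nlinarith
    have a₀ := mul_le_mul_of_nonneg_left (hlow u₀ hu₀) hc.le
    have a₁ := mul_le_mul_of_nonneg_left (hlow u₁ hu₁) hc.le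
    have a₂ := mul_le_mul_of_nonneg_left (hlow u₂ hu₂) hc.le
    have b₀ := hup u₀ u₁ hu₀ hu₁
    have b₁ := hup u₁ u₂ hu₁ hu₂
    have b₂ := hup u₂ u₀ hu₂ hu₀
    nlinarith
  obtain ⟨j, hj⟩ := hmiss
  have hzO := hUO z hzU
  have hwO := hUO w hzw
  -- The continuation of $K\circ\log$ from $z$ over the disk; at $w$ it differs from the principal
  -- branch by exactly `fluxSign`.
  let q : ℂ → ℂ := fun u => K (log (z - O) + log ((u - O) / (z - O)))
  have hq : ContinuousOn q U := by
    refine hK.comp_continuousOn (ContinuousOn.add continuousOn_const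
      (ContinuousOn.clog (by fun_prop) fun u hu => div_mem_slitPlane_of_dist_lt (hUlt u hu)))
  have hq2 (u : ℂ) (hu : u ∈ U) : q u ^ 2 = h.symm u := by
    have h1 := sub_ne_zero.2 hzO
    have h2 := sub_ne_zero.2 (hUO u hu)
    simp only [q]
    rw [hK2, exp_add, exp_log h1, exp_log (div_ne_zero h2 h1), mul_div_cancel₀ _ h1,
      add_sub_cancel]
  have key : q z * η w = blockSign reg z w * (q w * η z) :=
    sqrt_ratio_eq_blockSign (convex_closedBall _ _).isPreconnected (by fun_prop) hq hq2
      (fun u hu => hρ u (hUO u hu)) hθ₁ hθ₂ hpolar j hj hzU hzw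
  have hqz : q z = v z * η z := by
    simp only [q, v, if_neg hzO]
    rw [div_self (sub_ne_zero.2 hzO), log_one, add_zero, div_mul_cancel₀ _ (hη0 z)]
  have hqw : q w = fluxSign O z w * (v w * η w) := by
    obtain ⟨n, h1, h2⟩ := exists_fluxSign_eq hzO hwO
    simp only [q, v, if_neg hwO]
    rw [h1, h2, antiperiodic_add_int_mul hKanti, div_mul_cancel₀ _ (hη0 w)]
  rw [hqz, hqw] at key
  have key2 : v z = blockSign reg z w * fluxSign O z w * v w := by
    refine mul_right_cancel₀ (mul_ne_zero (hη0 z) (hη0 w)) ?_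
    linear_combination key
  have hσ : blockSign reg z w = 1 ∨ blockSign reg z w = -1 := by
    unfold blockSign
    split_ifs <;> simp
  rw [key2]
  rcases hσ with h1 | h1 <;> rcases hv w with h2 | h2 <;> simp [h1, h2]

end Regions

/-! ### Sign cocycles on graphs. -/

section Coboundary

variable {V : Type*} {G : SimpleGraph V}

/-- The product of edge weights along a walk. -/
def SimpleGraph.Walk.edgeProd (r : V → V → ℂ) : {v w : V} → G.Walk v w → ℂ
  | _, _, .nil => 1
  | v, _, .cons (v := v') _ p => r v v' * p.edgeProd r

theorem SimpleGraph.Walk.edgeProd_append (r : V → V → ℂ) {u v w : V} (p : G.Walk u v)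
    (q : G.Walk v w) : (p.append q).edgeProd r = p.edgeProd r * q.edgeProd r := by
  induction p with
  | nil => simp [edgeProd]
  | cons h p ih => simp [edgeProd, ih, mul_assoc]

theorem SimpleGraph.Walk.edgeProd_eq (r : V → V → ℂ) {v w : V} (p : G.Walk v w) :
    p.edgeProd r = ∏ i ∈ Finset.range p.length, r (p.getVert i) (p.getVert (i + 1)) := by
  induction p with
  | nil => simp [edgeProd]
  | cons h p ih =>
    rw [length_cons, Finset.prod_range_succ', edgeProd, ih, mul_comm]
    simp

theorem SimpleGraph.Walk.edgeProd_eq_one_or {r : V → V → ℂ}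
    (hr : ∀ v w, G.Adj v w → r v w = 1 ∨ r v w = -1) {v w : V} (p : G.Walk v w) :
    p.edgeProd r = 1 ∨ p.edgeProd r = -1 := by
  induction p with
  | nil => exact Or.inl rfl
  | cons h p ih => rcases hr _ _ h with h1 | h1 <;> rcases ih with h2 | h2 <;>
      simp [edgeProd, h1, h2]

/-- Signs on the edges of a graph with trivial products along closed walks form a coboundary. -/
theorem SimpleGraph.exists_sign_coboundary {r : V → V → ℂ}
    (hr : ∀ v w, G.Adj v w → r v w = 1 ∨ r v w = -1)
    (hloop : ∀ (v : V) (p : G.Walk v v), p.edgeProd r = 1) :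
    ∃ u : V → ℂ, (∀ v, u v = 1 ∨ u v = -1) ∧ ∀ v w, G.Adj v w → r v w = u v * u w := by
  let rep : V → V := fun v => (G.connectedComponentMk v).out
  have hrep (v : V) : G.Reachable (rep v) v :=
    SimpleGraph.ConnectedComponent.exact (Quot.out_eq (G.connectedComponentMk v))
  let W (v : V) : G.Walk (rep v) v := (hrep v).some
  refine ⟨fun v => (W v).edgeProd r, fun v => (W v).edgeProd_eq_one_or hr, fun v w h => ?_⟩
  have heq : rep w = rep v := by
    have : G.connectedComponentMk w = G.connectedComponentMk v :=
      SimpleGraph.ConnectedComponent.sound h.symm.reachable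
    simp only [rep, this]
  -- Following the edge and then $p$ backwards, or $p$ and then $p$ backwards, closes up with
  -- product $1$; cancelling the common return shows path independence. The free endpoint $a$ allows
  -- the two representatives to be identified by `subst`.
  have key (a : V) (p : G.Walk a w) (ha : a = rep v) : (W v).edgeProd r * r v w = p.edgeProd r := by
    subst ha
    have h1 := hloop _ (((W v).append (.cons h .nil)).append p.reverse)
    have h2 := hloop _ (p.append p.reverse)
    simp only [SimpleGraph.Walk.edgeProd_append, SimpleGraph.Walk.edgeProd, mul_one] at h1 h2
    have h3 : p.reverse.edgeProd r ≠ 0 := right_ne_zero_of_mul (h2 ▸ one_ne_zero)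
    exact mul_right_cancel₀ h3 (h1.trans h2.symm)
  have h1 := key _ (W w) heq
  change r v w = (W v).edgeProd r * (W w).edgeProd r
  rw [← h1]
  rcases (W v).edgeProd_eq_one_or hr with h2 | h2 <;> simp [h2]

end Coboundary

/-! ### Half flux phases up to gauge. -/

section HalfFlux

open Complex

/-- The half flux signs detect the parity of the winding number. -/
theorem prod_fluxSign {O : ℂ} {n : ℕ} {p : ℕ → ℂ} (hclosed : p n = p 0) (hO : ∀ i, p i ≠ O) :
    (LoopEncloses O n p → ∏ i ∈ Finset.range n, fluxSign O (p i) (p (i + 1)) = -1) ∧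
    (¬ LoopEncloses O n p → ∏ i ∈ Finset.range n, fluxSign O (p i) (p (i + 1)) = 1) := by
  have hsub (i) : p i - O ≠ 0 := sub_ne_zero.2 (hO i)
  -- Around the closed polygon the logarithms of vertices and the moduli of the ratios telescope
  -- away; only the sum of the angles remains.
  have hprod : ∏ i ∈ Finset.range n, fluxSign O (p i) (p (i + 1)) =
      exp (-(polygonWinding O n p * (Real.pi * I))) := by
    simp only [fluxSign]
    rw [← exp_sum, ← Finset.sum_div, Finset.sum_sub_distrib,
      Finset.sum_range_sub (fun i => log (p i - O)), hclosed, sub_self, zero_sub]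
    congr 1
    have hlog (i : ℕ) : log ((p (i + 1) - O) / (p i - O)) =
        ((Real.log ‖p (i + 1) - O‖ - Real.log ‖p i - O‖ : ℝ) : ℂ) +
          (arg ((p (i + 1) - O) / (p i - O)) : ℝ) * I := by
      rw [log, norm_div, Real.log_div (norm_ne_zero_iff.2 (hsub _)) (norm_ne_zero_iff.2 (hsub _))]
    simp only [hlog]
    rw [Finset.sum_add_distrib, ← ofReal_sum,
      Finset.sum_range_sub (fun i => Real.log ‖p i - O‖), hclosed, sub_self, ← Finset.sum_mul,
      ← ofReal_sum, polygonWinding]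
    have : (Real.pi : ℂ) ≠ 0 := ofReal_ne_zero.2 Real.pi_ne_zero
    push_cast
    field_simp
    ring
  have hpm : ∏ i ∈ Finset.range n, fluxSign O (p i) (p (i + 1)) = 1 ∨
      ∏ i ∈ Finset.range n, fluxSign O (p i) (p (i + 1)) = -1 := by
    clear hprod hclosed
    induction n with
    | zero => simp
    | succ n ih =>
      rw [Finset.prod_range_succ]
      rcases ih with h1 | h1 <;> rcases fluxSign_eq_one_or (hO n) (hO (n + 1)) with h2 | h2 <;>
        simp [h1, h2]
  have hint (k : ℤ) (hk : polygonWinding O n p = k) :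
      ∏ i ∈ Finset.range n, fluxSign O (p i) (p (i + 1)) = exp ((-k : ℤ) * (Real.pi * I)) := by
    rw [hprod, hk]
    push_cast
    ring_nf
  constructor
  · rintro ⟨k, hodd, hk⟩
    rw [hint k hk, exp_int_mul_pi_mul_I_of_odd hodd.neg]
  · intro hnot
    refine hpm.resolve_right fun hneg => hnot ?_
    have h1 : exp (-(polygonWinding O n p * (Real.pi * I))) = exp (Real.pi * I) := by
      rw [← hprod, hneg, exp_pi_mul_I]
    rw [exp_eq_exp_iff_exists_int] at h1
    obtain ⟨m, hm⟩ := h1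
    have h2 : (Real.pi : ℂ) * I ≠ 0 := mul_ne_zero (ofReal_ne_zero.2 Real.pi_ne_zero) I_ne_zero
    have h3 : (polygonWinding O n p : ℂ) = ((-(2 * m + 1) : ℤ) : ℂ) := by
      refine mul_right_cancel₀ h2 ?_
      push_cast
      linear_combination -hm
    exact ⟨-(2 * m + 1), ⟨-m - 1, by ring⟩, by exact_mod_cast h3⟩

/-- Half flux phases are gauge equivalent to signs, which agree up to gauge with the half flux
signs on pairs of sites whose segment avoids `O`. -/
theorem IsHalfFluxPhase.exists_gauge_fluxSign {O : ℂ} {S : Set ℂ} {s : ℂ → ℂ → ℂ}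
    (hs : IsHalfFluxPhase O S s) :
    ∃ a u : ℂ → ℂ, (∀ z ∈ S, ‖a z‖ = 1) ∧ (∀ z, u z = 1 ∨ u z = -1) ∧
      (∀ z ∈ S, ∀ w ∈ S, conj (a z) * s z w * a w = 1 ∨ conj (a z) * s z w * a w = -1) ∧
      ∀ z ∈ S, ∀ w ∈ S, O ∉ segment ℝ z w →
        conj (a z) * s z w * a w = u z * u w * fluxSign O z w := by
  rcases S.eq_empty_or_nonempty with rfl | ⟨x₀, hx₀⟩
  · exact ⟨1, 1, by simp, by simp, by simp, by simp⟩
  -- Gauging to a base point turns $s'_{z,w}$ into the flux through the triangle $x_0,z,w$, hence a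
  -- sign. The triangle may pass through $O$, which is where `loop_through` is needed.
  let a : ℂ → ℂ := fun z => s z x₀
  let s' : ℂ → ℂ → ℂ := fun z w => conj (a z) * s z w * a w
  have ha (z) (hz : z ∈ S) : ‖a z‖ = 1 := hs.norm_eq_one z hz x₀ hx₀
  have hs' (z) (hz : z ∈ S) (w) (hw : w ∈ S) : s' z w = 1 ∨ s' z w = -1 := by
    let p : ℕ → ℂ := fun i => if i = 1 then z else if i = 2 then w else x₀
    have hp (i) : p i ∈ S := by
      simp only [p]
      split_ifs <;> assumption
    have hprod : ∏ i ∈ Finset.range 3, s (p i) (p (i + 1)) = s' z w := by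
      simp [Finset.prod_range_succ, p, s', a, ← hs.symm z hz x₀ hx₀]
    rw [← hprod]
    by_cases hthrough : PolygonPassesThrough O 3 p
    · exact hs.loop_through 3 p hp (by simp [p]) hthrough
    · have h1 := hs.loop 3 p hp (by simp [p]) hthrough
      by_cases henc : LoopEncloses O 3 p
      · exact Or.inr (h1.1 henc)
      · exact Or.inl (h1.2 henc)
  have hloop (n : ℕ) (p : ℕ → ℂ) (hp : ∀ i, p i ∈ S) (hpn : p n = p 0) :
      ∏ i ∈ Finset.range n, s' (p i) (p (i + 1)) = ∏ i ∈ Finset.range n, s (p i) (p (i + 1)) := by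
    have hne (i) : a (p i) ≠ 0 := norm_ne_zero_iff.1 (by rw [ha _ (hp i)]; exact one_ne_zero)
    have hca (i) : conj (a (p i)) = (a (p i))⁻¹ := by
      rw [inv_def, normSq_eq_norm_sq, ha _ (hp i)]
      simp
    have h1 : ∏ i ∈ Finset.range n, a (p (i + 1)) = ∏ i ∈ Finset.range n, a (p i) := by
      have h2 := Finset.prod_range_succ (fun i => a (p i)) n
      rw [Finset.prod_range_succ', hpn] at h2
      exact mul_right_cancel₀ (hne 0) h2
    simp only [s', hca]
    rw [Finset.prod_mul_distrib, Finset.prod_mul_distrib, h1, Finset.prod_inv_distrib, mul_comm,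
      ← mul_assoc, mul_inv_cancel₀ (Finset.prod_ne_zero_iff.2 fun i _ => hne i), one_mul]
  let G : SimpleGraph S :=
    { Adj := fun z w => z ≠ w ∧ O ∉ segment ℝ (z : ℂ) w
      symm := ⟨fun z w h => ⟨h.1.symm, by rw [segment_symm]; exact h.2⟩⟩
      loopless := ⟨fun z h => h.1 rfl⟩ }
  have hO₁ {z w : ℂ} (h : O ∉ segment ℝ z w) : z ≠ O := by
    rintro rfl
    exact h (left_mem_segment ℝ _ _)
  have hO₂ {z w : ℂ} (h : O ∉ segment ℝ z w) : w ≠ O := by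
    rintro rfl
    exact h (right_mem_segment ℝ _ _)
  let r : S → S → ℂ := fun z w => s' z w * fluxSign O z w
  obtain ⟨u, hu, hcob⟩ := G.exists_sign_coboundary (r := r) (fun z w h => by
    rcases hs' z z.2 w w.2 with h1 | h1 <;>
      rcases fluxSign_eq_one_or (hO₁ h.2) (hO₂ h.2) with h2 | h2 <;> simp [r, h1, h2])
    (fun v p => by
      rw [p.edgeProd_eq]
      -- A trivial walk may sit at $O$ itself; on any longer walk every vertex ends an edge that
      -- avoids $O$.
      by_cases hlen : p.length = 0
      · simp [hlen]
      let P : ℕ → ℂ := fun i => (p.getVert i : ℂ)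
      have hclosed : P p.length = P 0 := by simp [P]
      have hadj (i) (hi : i < p.length) : O ∉ segment ℝ (P i) (P (i + 1)) :=
        (p.adj_getVert_succ hi).2
      have hPO (i) : P i ≠ O := by
        by_cases hi : i < p.length
        · exact hO₁ (hadj i hi)
        · have h1 : P i = P 0 := by
            simp only [P]
            rw [p.getVert_of_length_le (not_lt.1 hi), p.getVert_zero]
          rw [h1]
          exact hO₁ (hadj 0 (Nat.pos_of_ne_zero hlen))
      have hnot : ¬ PolygonPassesThrough O p.length P := by
        rintro ⟨i, hi, h⟩
        exact hadj i hi h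
      have hPS (i) : P i ∈ S := (p.getVert i).2
      have h1 := hs.loop p.length P hPS hclosed hnot
      have h2 := prod_fluxSign hclosed hPO
      change ∏ i ∈ Finset.range p.length, (s' (P i) (P (i + 1)) * fluxSign O (P i) (P (i + 1))) = 1
      rw [Finset.prod_mul_distrib, hloop _ P hPS hclosed]
      by_cases henc : LoopEncloses O p.length P
      · rw [h1.1 henc, h2.1 henc]
        norm_num
      · rw [h1.2 henc, h2.2 henc, one_mul])
  classical
  refine ⟨a, fun z => if hz : z ∈ S then u ⟨z, hz⟩ else 1, ha, fun z => ?_, hs', ?_⟩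
  · simp only
    split_ifs
    · exact hu _
    · exact Or.inl rfl
  · intro z hz w hw hzw
    simp only [dif_pos hz, dif_pos hw]
    by_cases heq : z = w
    · subst heq
      have h1 : fluxSign O z z = 1 := by
        simp [fluxSign, div_self (sub_ne_zero.2 (hO₁ hzw))]
      rw [hs.diag z hz, h1, mul_one, mul_one, mul_comm, mul_conj, normSq_eq_norm_sq, ha z hz]
      rcases hu ⟨z, hz⟩ with h2 | h2 <;> simp [h2]
    · have h1 : s' z w * fluxSign O z w = u ⟨z, hz⟩ * u ⟨w, hw⟩ :=
        hcob ⟨z, hz⟩ ⟨w, hw⟩ ⟨fun h => heq (congrArg Subtype.val h), hzw⟩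
      rw [← h1]
      rcases fluxSign_eq_one_or (hO₁ hzw) (hO₂ hzw) with h2 | h2 <;> simp [s', h2]

end HalfFlux

/-! ### Comparison of the two constructions and conclusion. -/

/-- Away from the vertex, and for close pairs of sites, half flux phases are gauge equivalent to
the sign pattern of a good partition. -/
theorem IsHalfFluxPhase.exists_gauge_blockSign {O : ℂ} {S : Set ℂ} {s : ℂ → ℂ → ℂ}
    (hs : IsHalfFluxPhase O S s) {reg : ℂ → Fin 3} (hreg : IsGoodPartition O reg) :
    ∃ (a v : ℂ → ℂ) (A B : ℝ), 0 < A ∧ (∀ z ∈ S, ‖a z‖ = 1) ∧ (∀ z, v z = 1 ∨ v z = -1) ∧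
      (∀ z ∈ S, ∀ w ∈ S, conj (a z) * s z w * a w = 1 ∨ conj (a z) * s z w * a w = -1) ∧
      ∀ z ∈ S, ∀ w ∈ S, conj (a z) * s z w * a w ≠ v z * v w * blockSign reg z w →
        dist z O + dist w O ≤ A * dist z w + B := by
  obtain ⟨a, u, ha, hu, hsgn, hflux⟩ := hs.exists_gauge_fluxSign
  obtain ⟨v, ε, R, hε, hε1, hR, hv, hblock⟩ := hreg.exists_gauge_fluxSign
  -- A failure forces $|z-O|\le R+|z-w|/\varepsilon$; adding $|w-O|\le|z-w|+|z-O|$ gives these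
  -- constants.
  refine ⟨a, fun z => u z * v z, 2 / ε + 1, 2 * R, by positivity, ha, fun z => ?_, hsgn, ?_⟩
  · rcases hu z with h1 | h1 <;> rcases hv z with h2 | h2 <;> simp [h1, h2]
  intro z hz w hw hne
  have hfar : dist z O ≤ R + dist z w / ε := by
    by_contra! hcon
    have hd : 0 ≤ dist z w / ε := by positivity
    have h1 : R ≤ dist z O := by linarith
    have h2 : dist w z ≤ ε * dist z O := by
      have h3 : dist z w / ε ≤ dist z O := by linarith
      rw [div_le_iff₀ hε] at h3
      rw [dist_comm]
      linarith
    refine hne ?_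
    have hseg : O ∉ segment ℝ z w := by
      intro hO
      have h3 : segment ℝ z w ⊆ Metric.closedBall z (ε * dist z O) :=
        (convex_closedBall z _).segment_subset (Metric.mem_closedBall_self (by positivity)) h2
      have h4 : dist O z ≤ ε * dist z O := h3 hO
      rw [dist_comm] at h4
      nlinarith
    rw [hflux z hz w hw hseg, hblock z w h1 h2]
    ring
  have h5 := dist_triangle w z O
  rw [dist_comm w z] at h5
  have h6 : (2 / ε + 1) * dist z w = 2 * (dist z w / ε) + dist z w := by ring
  linarith

theorem IsNuclear.sub_sq_add.{w, w'} {H : Type w'} [NormedAddCommGroup H] [InnerProductSpace ℂ H]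
    [CompleteSpace H] {Q D : H →L[ℂ] H} (hQ : IsNuclear.{w} (Q - Q * Q)) (hD : IsNuclear.{w} D) :
    IsNuclear.{w} ((Q + D) - (Q + D) * (Q + D)) := by
  have : (Q + D) - (Q + D) * (Q + D) = (Q - Q * Q) + D - (Q * D + D * (Q + D)) := by
    rw [add_mul, mul_add]
    abel
  rw [this]
  exact (hQ.add hD).sub ((hD.mul_left Q).add (hD.mul_right _))

/-- Twists by phases that agree on close pairs of sites away from `O` differ by a nuclear
operator. -/
theorem IsTwistOf.exists_isTwistOf_isNuclear_sub.{w, w'} {ι : Type w} {H : Type w'}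
    [NormedAddCommGroup H] [InnerProductSpace ℂ H] [CompleteSpace H] {b : HilbertBasis ι ℂ H}
    {pos : ι → ℂ} (hpos : HasBoundedDensity pos) {P Q : H →L[ℂ] H} (hdecay : HasExpDecay b pos P)
    {τ : ℂ → ℂ → ℂ} (hQ : IsTwistOf b pos τ P Q) (t : ℂ → ℂ → ℂ)
    (hτ : ∀ x y, ‖τ (pos x) (pos y)‖ = 1) (ht : ∀ x y, ‖t (pos x) (pos y)‖ = 1) {O : ℂ} {A B : ℝ}
    (hA : 0 < A) (hfar : ∀ x y, t (pos x) (pos y) ≠ τ (pos x) (pos y) →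
      dist (pos x) O + dist (pos y) O ≤ A * dist (pos x) (pos y) + B) :
    ∃ D : H →L[ℂ] H, IsTwistOf b pos t P (Q + D) ∧ IsNuclear.{w} D := by
  obtain ⟨C, c, hC, hc, hdec⟩ := hdecay
  have hsum : Summable fun p : ι × ι => ‖(t (pos p.1) (pos p.2) - τ (pos p.1) (pos p.2)) *
      matEntry b P p.1 p.2‖ := by
    refine hpos.summable_of_near O (m := fun x y => (t (pos x) (pos y) - τ (pos x) (pos y)) *
      matEntry b P x y) (C := 2 * C) (B := B) (by positivity) hc hA (fun x y => ?_)
      fun x y hxy => ?_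
    · rw [norm_mul, mul_assoc]
      gcongr
      · refine (norm_sub_le _ _).trans ?_
        rw [hτ, ht]
        norm_num
      · exact hdec x y
    · exact hfar x y fun h => left_ne_zero_of_mul hxy (sub_eq_zero.2 h)
  obtain ⟨D, hD⟩ := exists_matEntry_eq_of_summable b
    (fun x y => (t (pos x) (pos y) - τ (pos x) (pos y)) * matEntry b P x y) hsum
  refine ⟨D, fun x y => ?_, isNuclear_of_summable_matEntry b (by simpa only [hD] using hsum)⟩
  rw [matEntry_add, hQ, hD]
  ring

theorem mainTheorem7 {ι H : Type*}
    [NormedAddCommGroup H] [InnerProductSpace ℂ H] [CompleteSpace H]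
    (b : HilbertBasis ι ℂ H) (pos : ι → ℂ) (hpos : HasBoundedDensity pos)
    (P : H →L[ℂ] H) (hP : IsStarProjection P) (hdecay : HasExpDecay b pos P)
    (T : H ≃ₛₗᵢ[starRingEnd ℂ] H) (hT : IsTimeReversal b pos T) (hTP : ∀ v, T (P v) = P (T v))
    (O : ℂ) (reg : ℂ → Fin 3) (hreg : IsGoodPartition O reg)
    (s : ℂ → ℂ → ℂ) (hs : IsHalfFluxPhase O (Set.range pos) s) :
    ∃ Qt Qg : H →L[ℂ] H,
      IsTwistOf b pos (blockSign reg) P Qt ∧ IsTwistOf b pos s P Qg ∧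
      IsSelfAdjoint Qt ∧ IsSelfAdjoint Qg ∧
      ∀ μ ∈ Set.Ioo (0 : ℝ) 1, ∀ μ' ∈ Set.Ioo (0 : ℝ) 1,
        IsTraceClassOp b (Qt - specFlatten μ Qt) ∧
        IsTraceClassOp b (Qg - specFlatten μ' Qg) ∧
        ∃ k : ℤ, vertexTrace b μ Qt - vertexTrace b μ' Qg = 2 * k := by
  obtain ⟨a, v, A, B, hA, ha, hv, hsgn, hfar⟩ := hs.exists_gauge_blockSign hreg
  have hrange (x : ι) : pos x ∈ Set.range pos := ⟨x, rfl⟩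
  have hblock (z w : ℂ) : blockSign reg z w = 1 ∨ blockSign reg z w = -1 := by
    unfold blockSign
    split_ifs <;> simp
  -- Both patterns are gauged to real signs, since complex phases need not be compatible with $T$.
  let t : ℂ → ℂ → ℂ := fun z w => conj (a z) * s z w * a w
  let τ : ℂ → ℂ → ℂ := fun z w => v z * v w * blockSign reg z w
  have ht (x y) : t (pos x) (pos y) = 1 ∨ t (pos x) (pos y) = -1 :=
    hsgn _ (hrange x) _ (hrange y)
  have hτ (z w) : τ z w = 1 ∨ τ z w = -1 := by
    rcases hv z with h1 | h1 <;> rcases hv w with h2 | h2 <;> rcases hblock z w with h3 | h3 <;>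
      simp [τ, h1, h2, h3]
  have hreal {c : ℂ} (hc : c = 1 ∨ c = -1) : conj c = c := by
    rcases hc with rfl | rfl <;> simp
  have ha' (x : ι) : ‖a (pos x)‖ = 1 := ha _ (hrange x)
  have hv' (x : ι) : ‖v (pos x)‖ = 1 := by rcases hv (pos x) with h | h <;> simp [h]
  have haa (x : ι) : a (pos x) * conj (a (pos x)) = 1 := by
    rw [Complex.mul_conj, Complex.normSq_eq_norm_sq, ha']
    simp
  obtain ⟨Ga, hGa⟩ := b.exists_gauge (fun x => a (pos x)) ha'
  obtain ⟨Gv, hGv⟩ := b.exists_gauge (fun x => v (pos x)) hv'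
  obtain ⟨Qt, hQt⟩ := exists_isTwistOf_blockSign b pos reg P
  have hQtn := hQt.isNuclear_sub_sq hpos hP hdecay hreg
  have hnorm {c : ℂ} (hc : c = 1 ∨ c = -1) : ‖c‖ = 1 := by
    rcases hc with rfl | rfl <;> simp
  have hQ₂ : IsTwistOf b pos τ P (Gv.conjStarAlgEquiv Qt) := fun x y => by
    rw [matEntry_conj_gauge hv' hGv, hQt, hreal (hv _)]
    simp only [τ]
    ring
  have hQtsa : IsSelfAdjoint Qt := hQt.isSelfAdjoint hP.isSelfAdjoint fun x y => by
    rw [hreal (hblock _ _)]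
    simp only [blockSign, eq_comm]
  have hn₂ := hQtn.conj Gv
  have hsa₂ := hQtsa.conj_gauge Gv
  rw [map_sub, map_mul] at hn₂
  -- The existence of $Q^g$ as a bounded operator comes from here: it is this nuclear perturbation
  -- of the gauged $Q^t$, with the gauge $a$ undone by `Ga`.
  obtain ⟨D, hQ₁, hD⟩ := hQ₂.exists_isTwistOf_isNuclear_sub hpos hdecay t
    (fun x y => hnorm (hτ _ _)) (fun x y => hnorm (ht x y)) hA
    (fun x y => hfar _ (hrange x) _ (hrange y))
  have hn₁ := hn₂.sub_sq_add hD
  have hsa₁ := hQ₁.isSelfAdjoint hP.isSelfAdjoint fun x y => by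
    simp only [t, map_mul, Complex.conj_conj]
    rw [hs.symm _ (hrange x) _ (hrange y)]
    ring
  have hdiff : IsNuclear (Gv.conjStarAlgEquiv Qt - (Gv.conjStarAlgEquiv Qt + D)) := by
    simpa using hD.neg
  have hdiag (x : ι) : matEntry b (Gv.conjStarAlgEquiv Qt) x x =
      matEntry b (Gv.conjStarAlgEquiv Qt + D) x x := by
    have h1 : τ (pos x) (pos x) = 1 := by
      rcases hv (pos x) with h | h <;> simp [τ, h, blockSign]
    have h2 : t (pos x) (pos x) = 1 := by
      simp only [t]
      rw [hs.diag _ (hrange x), mul_one, mul_comm, haa]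
    rw [hQ₂, hQ₁, h1, h2]
  have hT₂ := hT.apply_twist hTP hQ₂ fun x y => hreal (hτ _ _)
  have hT₁ := hT.apply_twist hTP hQ₁ fun x y => hreal (ht x y)
  generalize Gv.conjStarAlgEquiv Qt + D = Q₁ at *
  have hng := hn₁.conj Ga
  rw [map_sub, map_mul] at hng
  refine ⟨Qt, Ga.conjStarAlgEquiv Q₁, hQt, fun x y => ?_, hQtsa, hsa₁.conj_gauge Ga,
    fun μ hμ μ' hμ' => ⟨?_, ?_, ?_⟩⟩
  · rw [matEntry_conj_gauge ha' hGa, hQ₁]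
    simp only [t]
    linear_combination (s (pos x) (pos y) * matEntry b P x y) *
      (a (pos y) * conj (a (pos y)) * haa x + haa y)
  · exact (hQtn.sub_specFlatten hQtsa hμ).isTraceClassOp
      (hQtsa.sub (isStarProjection_specFlatten _ _).isSelfAdjoint) b
  · exact (hng.sub_specFlatten (hsa₁.conj_gauge Ga) hμ').isTraceClassOp
      ((hsa₁.conj_gauge Ga).sub (isStarProjection_specFlatten _ _).isSelfAdjoint) b
  · rw [vertexTrace_conj_gauge ha' hGa hsa₁ hn₁ hμ',
      ← vertexTrace_conj_gauge hv' hGv hQtsa hQtn hμ]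
    exact vertexTrace_sub_even b hsa₂ hsa₁ hn₂ hn₁ hdiff hdiag T hT.sq_eq_neg hT₂ hT₁ hμ hμ'

end
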